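/- For $n\ge 1$ and a finite nonempty alphabet $\Sigma$, an $n$-tape automaton has a finite state set $Q$, a map $\tau$ assigning to each state one of the $n$ tapes, a nondeterministic transition function $\delta\colon Q\times(\Sigma\cup\{\$\})\to 2^Q$, where $\$\notin\Sigma$ is an end marker, and sets of initial and accepting states. On input $\langle x_1,\dots,x_n\rangle\in(\Sigma^*)^n$ it starts in an initial state with $x_i\$$ on tape $i$. In state $q$ it reads the next symbol $\sigma$ of tape $\tau(q)$ (there is no move if nothing is left on that tape), removes it, and goes to some state of $\delta(q,\sigma)$. It accepts the input if some run reaches an accepting state. A language $L\subseteq(\Sigma^*)^n$ is rational if it is the set of inputs accepted by some $n$-tape automaton over $\Sigma$. The rational complement problem is: given (a finite description of) a nondeterministic multi-tape automaton $A$, with arbitrary number $n\ge 1$ of tapes and arbitrary finite nonempty alphabet $\Sigma$, determine whether the complement $(\Sigma^*)^n\setminus L(A)$ of the language $L(A)$ accepted by $A$ is rational. **Corollary.** The rational complement problem is not semidecidable; that is, the set of descriptions of automata $A$ for which $(\Sigma^*)^n\setminus L(A)$ is rational is not recursively enumerable. -/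

import Mathlib

/-- An asynchronous nondeterministic `n`-tape finite automaton over the alphabet `α` with state
set `Q` (finiteness of `α` and `Q` is required where automata are used). The extended alphabet
`α ∪ {$}` is `Option α`; the end marker `$` is `none`. -/
structure MultiTapeAutomaton (n : ℕ) (α Q : Type) where
  /-- the tape read in a given state -/
  tape : Q → Fin n
  /-- the nondeterministic transition function -/
  trans : Q → Option α → Set Q
  /-- the initial states -/
  start : Set Q
  /-- the accepting states -/
  accept : Set Q

namespace MultiTapeAutomaton

variable {n : ℕ} {α Q : Type}

/-- A configuration: the current state and, for each tape, the input still to be read. -/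
abbrev Config (n : ℕ) (α Q : Type) : Type := Q × (Fin n → List (Option α))

/-- One move: the symbol under the head of the tape selected by the current state is consumed.
All other tapes are unchanged. -/
def Step (A : MultiTapeAutomaton n α Q) (c c' : Config n α Q) : Prop :=
  ∃ (s : Option α) (y : List (Option α)),
    c.2 (A.tape c.1) = s :: y ∧ c'.1 ∈ A.trans c.1 s ∧
      c'.2 = Function.update c.2 (A.tape c.1) y

/-- The initial content of the tapes on input `x`: each component followed by `$`. -/
def inputTapes (x : Fin n → List α) : Fin n → List (Option α) :=
  fun i => (x i).map some ++ [none]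

/-- `A` accepts the `n`-word `x` if some run on `x` reaches an accepting state (the tapes need not
have been read completely). -/
def Accepts (A : MultiTapeAutomaton n α Q) (x : Fin n → List α) : Prop :=
  ∃ q₀ ∈ A.start, ∃ q ∈ A.accept, ∃ y : Fin n → List (Option α),
    Relation.ReflTransGen A.Step (q₀, inputTapes x) (q, y)

/-- The language of `n`-words accepted by `A`. -/
def language (A : MultiTapeAutomaton n α Q) : Set (Fin n → List α) :=
  {x | A.Accepts x}

end MultiTapeAutomaton

/-- A language of `n`-words over `α` is rational if some finite `n`-tape automaton accepts it. -/
def IsRationalLanguage {n : ℕ} {α : Type} (L : Set (Fin n → List α)) : Prop :=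
  ∃ (Q : Type) (_ : Finite Q) (A : MultiTapeAutomaton n α Q), A.language = L

/-- Finite descriptions of multi-tape automata, the inputs of decision problems about automata.
The tuple `(n, k, m, tapes, trans, start, accept)` describes an automaton with `n + 1` tapes,
an alphabet of `k + 1` letters and `m` states: `tapes` lists the tapes of the states,
`trans` lists the transitions `(q, s, q')`, where `s = none` stands for the end marker, and
`start` and `accept` list the initial and the accepting states. -/
abbrev AutomatonCode : Type :=
  ℕ × ℕ × ℕ × List ℕ × List (ℕ × Option ℕ × ℕ) × List ℕ × List ℕ

namespace AutomatonCode

/-- The number of tapes, which is at least one. -/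
abbrev numTapes (c : AutomatonCode) : ℕ := c.1 + 1

/-- The number of letters of the (nonempty) input alphabet. -/
abbrev numLetters (c : AutomatonCode) : ℕ := c.2.1 + 1

/-- The number of states. -/
abbrev numStates (c : AutomatonCode) : ℕ := c.2.2.1

/-- The automaton described by a code. List entries that are not states or letters are ignored,
missing tape entries are read as `0`, and tape entries are taken modulo the number of tapes, so
every code describes an automaton. -/
def toAutomaton (c : AutomatonCode) :
    MultiTapeAutomaton (numTapes c) (Fin (numLetters c)) (Fin (numStates c)) where
  tape q := Fin.ofNat (c.1 + 1) (c.2.2.2.1.getD q.val 0)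
  trans q s := {q' | (q.val, s.map Fin.val, q'.val) ∈ c.2.2.2.2.1}
  start := {q | q.val ∈ c.2.2.2.2.2.1}
  accept := {q | q.val ∈ c.2.2.2.2.2.2}

/-- Every automaton, with tapes, letters and states numbered, is described by some code. -/
theorem exists_code (n k m : ℕ) (A : MultiTapeAutomaton (n + 1) (Fin (k + 1)) (Fin m)) :
    ∃ (tapes : List ℕ) (tr : List (ℕ × Option ℕ × ℕ)) (st ac : List ℕ),
      toAutomaton (n, k, m, tapes, tr, st, ac) = A := by
  classical
  refine ⟨List.ofFn fun q => (A.tape q).val,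
    ((Finset.univ : Finset (Fin m × Option (Fin (k + 1)) × Fin m)).filter
      (fun t => t.2.2 ∈ A.trans t.1 t.2.1)).toList.map
        (fun t => (t.1.val, t.2.1.map Fin.val, t.2.2.val)),
    ((Finset.univ : Finset (Fin m)).filter (· ∈ A.start)).toList.map Fin.val,
    ((Finset.univ : Finset (Fin m)).filter (· ∈ A.accept)).toList.map Fin.val, ?_⟩
  obtain ⟨tape, trans, start, accept⟩ := A
  change (MultiTapeAutomaton.mk _ _ _ _ :
    MultiTapeAutomaton (n + 1) (Fin (k + 1)) (Fin m)) = MultiTapeAutomaton.mk _ _ _ _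
  rw [MultiTapeAutomaton.mk.injEq]
  refine ⟨?_, ?_, ?_, ?_⟩
  · funext q
    apply Fin.ext
    have hq : q.val < m := q.isLt
    simp [List.getD, hq]
  · funext q s
    ext q'
    have hinj : Function.Injective (Option.map (Fin.val : Fin (k + 1) → ℕ)) :=
      Option.map_injective Fin.val_injective
    simp only [Set.mem_ofPred_eq, List.mem_map, Finset.mem_toList, Finset.mem_filter,
      Finset.mem_univ, true_and, Prod.mk.injEq]
    constructor
    · rintro ⟨⟨a, b, d⟩, h, h1, h2, h3⟩
      obtain rfl := Fin.ext h1
      obtain rfl := hinj h2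
      obtain rfl := Fin.ext h3
      exact h
    · intro h
      exact ⟨(q, s, q'), h, rfl, rfl, rfl⟩
  · ext q
    simp [Fin.val_inj]
  · ext q
    simp [Fin.val_inj]

end AutomatonCode

/-- The rational complement problem: given a (nondeterministic) multi-tape automaton with language
`L`, is the complement of `L` in the set of all `n`-words rational? -/
def RationalComplement (c : AutomatonCode) : Prop :=
  IsRationalLanguage (AutomatonCode.toAutomaton c).languageᶜ

/-! The non-halting problem is reduced to the rational complement problem. Fix a set S of tuples,
with rational complement, such that `0^n` occurs on one tape exactly if the n-th program halts on
input 0, while another tape carries words u0u, where u can be any word over {0, 1} whatever the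
halting n. A chain of states that rejects only `0^n` turns the automaton for the complement of S
into one whose complement is the slice of S at n, computably in n. If the program does not halt, the
slice is empty, hence rational. If it halts, the slice contains tuples with `1^j 0 1^j` for every j,
and a finite automaton accepting the slice would also accept a tuple with `1^j 0 1^l` for some j ≠ l
(`exists_accepts_splice`), which is not of the form u0u. A semidecision procedure would therefore
enumerate the non-halting programs.

The existence of S rests on the fact that co-rational sets can describe computations: an automaton
recognizing the complement only has to guess and verify one error. Hence these sets are closed under
finite intersections and under block stars (`CoRat.blockStar`), and contain concatenation with a
separator (`CoRat.cat`). Existential quantifiers cost nothing, because a quantified word is simply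
kept as one more tape (`ProjCoRat`).

The decisive step is closure under transitive closure (`Representable.transGen`). A chain of related
pairs is a block star; that consecutive pairs fit together is an equation, in each coordinate,
between the words of left and right components shifted by one block. Transitive closures give
primitive recursion and unbounded search, so graphs of all partial recursive functions are
projections of co-rational sets. -/

/-! ### Automata with arbitrary tape index types -/

/-- A nondeterministic automaton whose tapes are indexed by an arbitrary type. -/
structure TapeAut (ι α Q : Type) where
  /-- the tape read in a given state -/
  tape : Q → ι
  /-- the nondeterministic transition function -/
  trans : Q → Option α → Set Q
  /-- the initial states -/
  start : Set Q
  /-- the accepting states -/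
  accept : Set Q

open Classical in
/-- Replace the content of the tape `i` by `y`. -/
noncomputable def setTape {ι β : Type} (t : ι → β) (i : ι) (y : β) : ι → β :=
  Function.update t i y

section setTape
variable {ι β : Type}

@[simp] theorem setTape_self (t : ι → β) (i : ι) (y : β) : setTape t i y i = y := by
  simp [setTape]

theorem setTape_of_ne (t : ι → β) {i j : ι} (y : β) (h : j ≠ i) : setTape t i y j = t j := by
  simp [setTape, h]

theorem setTape_comm (t : ι → β) {i j : ι} (h : i ≠ j) (x y : β) :
    setTape (setTape t i x) j y = setTape (setTape t j y) i x := by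
  classical
  simp only [setTape]
  exact Function.update_comm h x y t

@[simp] theorem setTape_setTape (t : ι → β) (i : ι) (x y : β) :
    setTape (setTape t i x) i y = setTape t i y := by
  simp [setTape]

end setTape

/-- A word followed by the end marker. -/
def endMarked {α : Type} (l : List α) : List (Option α) := l.map some ++ [none]

@[simp] theorem endMarked_nil {α : Type} : endMarked ([] : List α) = [none] := rfl

@[simp] theorem endMarked_cons {α : Type} (a : α) (l : List α) :
    endMarked (a :: l) = some a :: endMarked l := rfl

theorem endMarked_append {α : Type} (k l : List α) :
    endMarked (k ++ l) = k.map some ++ endMarked l := by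
  simp [endMarked]

theorem endMarked_map {α β : Type} (φ : α → β) (l : List α) :
    endMarked (l.map φ) = (endMarked l).map (Option.map φ) := by
  simp [endMarked]

/-- The marker stands only at the very end, so a nonempty remainder still contains it and the part
already read is a plain word. -/
theorem append_eq_endMarked {α : Type} {a b : List (Option α)} {l : List α}
    (h : a ++ b = endMarked l) (hb : b ≠ []) :
    ∃ u v, a = u.map some ∧ b = endMarked v ∧ l = u ++ v := by
  induction a generalizing l with
  | nil => exact ⟨[], l, rfl, by simpa using h, rfl⟩
  | cons s a ih =>
    cases l with
    | nil => simp_all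
    | cons c l =>
      simp only [List.cons_append, endMarked_cons, List.cons.injEq] at h
      obtain ⟨u, v, h1, h2, h3⟩ := ih h.2
      exact ⟨c :: u, v, by simp [h.1, h1], h2, by simp [h3]⟩

namespace TapeAut

variable {ι ι' α α' Q Q' : Type}

/-- From the state `q` with remaining tape contents `t` an accepting state can be reached. -/
inductive Acc (A : TapeAut ι α Q) : Q → (ι → List (Option α)) → Prop
  | done {q t} : q ∈ A.accept → Acc A q t
  | step {q t s y q'} : t (A.tape q) = s :: y → q' ∈ A.trans q s →
      Acc A q' (setTape t (A.tape q) y) → Acc A q t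

theorem acc_iff (A : TapeAut ι α Q) (q : Q) (t : ι → List (Option α)) :
    A.Acc q t ↔ q ∈ A.accept ∨ ∃ s y, t (A.tape q) = s :: y ∧
      ∃ q' ∈ A.trans q s, A.Acc q' (setTape t (A.tape q) y) := by
  constructor
  · rintro (h | ⟨h1, h2, h3⟩)
    · exact .inl h
    · exact .inr ⟨_, _, h1, _, h2, h3⟩
  · rintro (h | ⟨s, y, h1, q', h2, h3⟩)
    · exact .done h
    · exact .step h1 h2 h3

/-- Unfolding of acceptance in a non-accepting state whose tape is not exhausted. -/
theorem acc_iff_of_cons (A : TapeAut ι α Q) {q : Q} {t : ι → List (Option α)} {s y}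
    (hq : q ∉ A.accept) (h : t (A.tape q) = s :: y) :
    A.Acc q t ↔ ∃ q' ∈ A.trans q s, A.Acc q' (setTape t (A.tape q) y) := by
  rw [acc_iff]
  simp [hq, h]

theorem acc_iff_of_trans_eq (A : TapeAut ι α Q) {q q' : Q} {t : ι → List (Option α)} {s y}
    (hq : q ∉ A.accept) (h : t (A.tape q) = s :: y) (h' : A.trans q s = {q'}) :
    A.Acc q t ↔ A.Acc q' (setTape t (A.tape q) y) := by
  rw [A.acc_iff_of_cons hq h, h']
  simp

theorem not_acc_of_nil (A : TapeAut ι α Q) {q : Q} {t : ι → List (Option α)}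
    (hq : q ∉ A.accept) (h : t (A.tape q) = []) : ¬ A.Acc q t := by
  rw [acc_iff]
  simp [hq, h]

/-- The automaton accepts the tuple `x` of words. -/
def Accepts (A : TapeAut ι α Q) (x : ι → List α) : Prop :=
  ∃ q ∈ A.start, A.Acc q fun i => endMarked (x i)

/-- Acceptance is preserved and reflected by an embedding of automata. -/
theorem acc_hom {A : TapeAut ι α Q} {A' : TapeAut ι' α' Q'} (f : Q → Q') (ρ : ι → ι')
    (φ : α → α') (hρ : Function.Injective ρ)
    (htape : ∀ q, A'.tape (f q) = ρ (A.tape q))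
    (htrans : ∀ q s q'', q'' ∈ A'.trans (f q) (s.map φ) ↔ ∃ q' ∈ A.trans q s, f q' = q'')
    (hacc : ∀ q, f q ∈ A'.accept ↔ q ∈ A.accept) (q : Q)
    (t : ι → List (Option α)) (t' : ι' → List (Option α'))
    (ht : ∀ i, t' (ρ i) = (t i).map (Option.map φ)) :
    A'.Acc (f q) t' ↔ A.Acc q t := by
  have upd : ∀ {t : ι → List (Option α)} {t' : ι' → List (Option α')} (j y),
      (∀ i, t' (ρ i) = (t i).map (Option.map φ)) →
      ∀ i, setTape t' (ρ j) (y.map (Option.map φ)) (ρ i) =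
        (setTape t j y i).map (Option.map φ) := by
    intro t t' j y ht i
    by_cases hij : i = j
    · subst hij; simp
    · rw [setTape_of_ne _ _ hij, setTape_of_ne _ _ (fun h => hij (hρ h)), ht]
  constructor
  · intro h
    generalize hp : f q = p at h
    induction h generalizing q t with
    | done h => subst hp; exact .done ((hacc _).1 h)
    | @step p t' s y p' h1 h2 h3 ih =>
      subst hp
      rw [htape, ht] at h1
      obtain ⟨s0, y0, h4, rfl, rfl⟩ := List.map_eq_cons_iff.1 h1
      obtain ⟨q', h5, rfl⟩ := (htrans _ _ _).1 h2
      refine .step h4 h5 (ih _ _ ?_ rfl)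
      rw [htape]
      exact upd _ _ ht
  · intro h
    induction h generalizing t' with
    | done h => exact .done ((hacc _).2 h)
    | @step q t s y q' h1 h2 h3 ih =>
      have h4 : t' (A'.tape (f q)) = s.map φ :: y.map (Option.map φ) := by
        rw [htape, ht, h1]; rfl
      refine .step h4 ((htrans _ _ _).2 ⟨q', h2, rfl⟩) (ih _ ?_)
      rw [htape]
      exact upd _ _ ht

end TapeAut

/-! ### Sets with rational complement: basic closure properties -/

/-- A set of tuples of words over `ℕ` whose complement is accepted by a finite automaton. -/
def CoRat {ι : Type} (S : Set (ι → List ℕ)) : Prop :=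
  ∃ (Q : Type) (_ : Finite Q) (A : TapeAut ι ℕ Q), ∀ x, x ∈ S ↔ ¬ A.Accepts x

namespace CoRat

variable {ι ι' : Type}

/-- The same automaton ignores the additional tapes. Injectivity matters: two tapes merged into one
would need two independent heads on it. -/
theorem comap_injective {S : Set (ι → List ℕ)} (h : CoRat S) (ρ : ι → ι')
    (hρ : Function.Injective ρ) : CoRat {x : ι' → List ℕ | (fun i => x (ρ i)) ∈ S} := by
  obtain ⟨Q, hQ, A, hA⟩ := h
  refine ⟨Q, hQ, ⟨fun q => ρ (A.tape q), A.trans, A.start, A.accept⟩, fun x => ?_⟩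
  rw [Set.mem_ofPred_eq, hA]
  refine not_congr (exists_congr fun q => and_congr_right fun _ => ?_)
  refine (TapeAut.acc_hom id ρ id hρ ?_ ?_ ?_ q _ _ ?_).symm <;> simp

/-- Complementation turns the intersection into a union, which is recognized by the disjoint union
of the automata: the choice of the initial state selects the component. -/
theorem iInter {J : Type} [Finite J] {S : J → Set (ι → List ℕ)} (h : ∀ j, CoRat (S j)) :
    CoRat {x | ∀ j, x ∈ S j} := by
  choose Q hQ A hA using h
  let B : TapeAut ι ℕ (Σ j, Q j) :=
    ⟨fun q => (A q.1).tape q.2, fun q s => Sigma.mk q.1 '' (A q.1).trans q.2 s,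
      {q | q.2 ∈ (A q.1).start}, {q | q.2 ∈ (A q.1).accept}⟩
  have key : ∀ j q t, B.Acc ⟨j, q⟩ t ↔ (A j).Acc q t := by
    intro j q t
    refine TapeAut.acc_hom (A := A j) (A' := B) (Sigma.mk j) id id Function.injective_id
      ?_ ?_ ?_ q _ _ ?_ <;> simp [B]
  refine ⟨_, inferInstance, B, fun x => ?_⟩
  simp only [Set.mem_ofPred_eq, hA, TapeAut.Accepts, Sigma.exists, key, B]
  push Not
  rfl

theorem inter {S T : Set (ι → List ℕ)} (hS : CoRat S) (hT : CoRat T) : CoRat (S ∩ T) := by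
  have := iInter (J := Bool) (S := fun b => cond b S T) (by rintro (_ | _) <;> assumption)
  convert this using 1
  ext x
  simp [and_comm]

/-- All letters of the tape `i` satisfy `P`. -/
theorem letters (i : ι) (P : ℕ → Prop) : CoRat {x : ι → List ℕ | ∀ c ∈ x i, P c} := by
  let A : TapeAut ι ℕ Bool :=
    ⟨fun _ => i, fun b s => {b' | b = false ∧ ∃ c, s = some c ∧ (b' = true ↔ ¬ P c)},
      {false}, {true}⟩
  have key : ∀ (l : List ℕ) t, t i = endMarked l → (A.Acc false t ↔ ¬ ∀ c ∈ l, P c) := by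
    intro l
    induction l with
    | nil =>
      intro t ht
      rw [A.acc_iff_of_cons (by simp [A]) ht]
      simp [A]
    | cons c l ih =>
      intro t ht
      rw [A.acc_iff_of_cons (by simp [A]) (ht.trans (endMarked_cons c l))]
      have h1 : A.Acc true (setTape t i (endMarked l)) := .done rfl
      have h2 := ih (setTape t i (endMarked l)) (by simp)
      by_cases hc : P c
      · simpa [A, hc] using h2
      · simpa [A, hc] using h1
  refine ⟨Bool, inferInstance, A, fun x => ?_⟩
  simp only [TapeAut.Accepts, Set.mem_ofPred_eq]
  rw [show A.start = {false} from rfl]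
  simp [key (x i)]

end CoRat

/-! ### Concatenation with a separator -/

/-- The states of the automaton recognizing the negation of `z = x ++ c :: y`: reading one of the
two factors, expecting a letter of `z`, expecting the separator, and expecting the end. -/
inductive CatState (k : ℕ)
  | read (b : Bool)
  | expect (b : Bool) (a : Fin k)
  | sep
  | fin
  | acc

namespace CatState

instance (k : ℕ) : Finite (CatState k) :=
  Finite.of_surjective
    (fun p : Bool ⊕ (Bool × Fin k) ⊕ Fin 3 => match p with
      | .inl b => .read b
      | .inr (.inl (b, a)) => .expect b a
      | .inr (.inr 0) => .sep
      | .inr (.inr 1) => .fin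
      | .inr (.inr 2) => .acc)
    (by
      rintro (b | ⟨b, a⟩ | _ | _ | _)
      · exact ⟨.inl b, rfl⟩
      · exact ⟨.inr (.inl (b, a)), rfl⟩
      · exact ⟨.inr (.inr 0), rfl⟩
      · exact ⟨.inr (.inr 1), rfl⟩
      · exact ⟨.inr (.inr 2), rfl⟩)

/-- The automaton recognizing the negation of `z = x ++ c :: y` for words `x`, `y` with letters
below `k`. The tapes are `x`, `y`, `z`. -/
def aut (k c : ℕ) : TapeAut (Fin 3) ℕ (CatState k) where
  tape
    | .read false => 0
    | .read true => 1
    | _ => 2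
  trans
    -- Letters not below `k` have no move, which keeps the set of `expect` states finite;
    -- `CoRat.cat` excludes such letters separately.
    | .read b, some a => {q | ∃ h : a < k, q = .expect b ⟨a, h⟩}
    | .read false, none => {.sep}
    | .read true, none => {.fin}
    | .expect b a, s => {if s = some a.val then .read b else .acc}
    | .sep, s => {if s = some c then .read true else .acc}
    | .fin, s => {q | s ≠ none ∧ q = .acc}
    | .acc, _ => ∅
  start := {.read false}
  accept := {.acc}

variable {k c : ℕ}

theorem acc_acc (t : Fin 3 → List (Option ℕ)) : (aut k c).Acc .acc t := .done rfl

theorem acc_fin {t : Fin 3 → List (Option ℕ)} {z : List ℕ} (hz : t 2 = endMarked z) :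
    (aut k c).Acc .fin t ↔ z ≠ [] := by
  cases z with
  | nil => rw [(aut k c).acc_iff_of_cons (by simp [aut]) hz]; simp [aut]
  | cons a z =>
    rw [(aut k c).acc_iff_of_trans_eq (q' := .acc) (by simp [aut]) hz (by simp [aut])]
    simp [acc_acc]

/-- A wrong symbol, the end marker included, leads to acceptance at once. So acceptance means that
if the expected letter is present, the continuation accepts, which is why the right-hand side is a
universal statement. -/
theorem acc_of_mismatch {q q₁ : CatState k} {a : ℕ} (hq : q ≠ .acc) (htape : (aut k c).tape q = 2)
    (htrans : ∀ s, (aut k c).trans q s = {if s = some a then q₁ else .acc})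
    {t : Fin 3 → List (Option ℕ)} {z : List ℕ} (hz : t 2 = endMarked z) :
    (aut k c).Acc q t ↔ ∀ z', z = a :: z' → (aut k c).Acc q₁ (setTape t 2 (endMarked z')) := by
  rw [← htape] at hz
  have hq' : q ∉ (aut k c).accept := hq
  cases z with
  | nil =>
    rw [(aut k c).acc_iff_of_trans_eq hq' hz (htrans _)]
    simp [acc_acc]
  | cons d z =>
    rw [(aut k c).acc_iff_of_trans_eq hq' (hz.trans (endMarked_cons d z)) (htrans _)]
    by_cases h : d = a <;> simp [acc_acc, h, htape]

theorem acc_expect {b : Bool} {a : Fin k} {t : Fin 3 → List (Option ℕ)} {z : List ℕ}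
    (hz : t 2 = endMarked z) :
    (aut k c).Acc (.expect b a) t ↔
      ∀ z', z = a.val :: z' → (aut k c).Acc (.read b) (setTape t 2 (endMarked z')) :=
  acc_of_mismatch (by simp) rfl (fun _ => rfl) hz

theorem acc_sep {t : Fin 3 → List (Option ℕ)} {z : List ℕ} (hz : t 2 = endMarked z) :
    (aut k c).Acc .sep t ↔
      ∀ z', z = c :: z' → (aut k c).Acc (.read true) (setTape t 2 (endMarked z')) :=
  acc_of_mismatch (by simp) rfl (fun _ => rfl) hz

theorem acc_read_true {y z : List ℕ} (hy : ∀ a ∈ y, a < k) {t : Fin 3 → List (Option ℕ)}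
    (h1 : t 1 = endMarked y) (h2 : t 2 = endMarked z) :
    (aut k c).Acc (.read true) t ↔ z ≠ y := by
  induction y generalizing t z with
  | nil =>
    rw [(aut k c).acc_iff_of_cons (by simp [aut]) h1]
    simp only [aut, Set.mem_singleton_iff, exists_eq_left]
    exact acc_fin (by rw [setTape_of_ne _ _ (by decide), h2])
  | cons a y ih =>
    have ha : a < k := hy a (by simp)
    rw [(aut k c).acc_iff_of_trans_eq (q' := .expect true ⟨a, ha⟩) (by simp [aut])
      (h1.trans (endMarked_cons a y)) (by simp [aut, ha])]
    change (aut k c).Acc (.expect true ⟨a, ha⟩) (setTape t 1 (endMarked y)) ↔ _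
    rw [acc_expect (z := z) (by rw [setTape_of_ne _ _ (by decide), h2])]
    have key : ∀ z', (aut k c).Acc (.read true) (setTape (setTape t 1 (endMarked y)) 2
        (endMarked z')) ↔ z' ≠ y := fun z' =>
      ih (fun b hb => hy b (by simp [hb])) (by rw [setTape_of_ne _ _ (by decide)]; simp) (by simp)
    simp only [key]
    constructor
    · rintro h rfl
      exact h y rfl rfl
    · rintro h z' rfl rfl
      exact h rfl

theorem acc_read_false {x y z : List ℕ} (hx : ∀ a ∈ x, a < k) (hy : ∀ a ∈ y, a < k)
    {t : Fin 3 → List (Option ℕ)} (h0 : t 0 = endMarked x) (h1 : t 1 = endMarked y)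
    (h2 : t 2 = endMarked z) :
    (aut k c).Acc (.read false) t ↔ z ≠ x ++ c :: y := by
  induction x generalizing t z with
  | nil =>
    rw [(aut k c).acc_iff_of_cons (by simp [aut]) h0]
    trans (aut k c).Acc .sep (setTape t 0 [])
    · simp [aut]
    rw [acc_sep (z := z) (by rw [setTape_of_ne _ _ (by decide), h2])]
    have key : ∀ z', (aut k c).Acc (.read true) (setTape (setTape t 0 []) 2
        (endMarked z')) ↔ z' ≠ y := fun z' =>
      acc_read_true hy (by rw [setTape_of_ne _ _ (by decide), setTape_of_ne _ _ (by decide), h1])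
        (by simp)
    simp only [key]
    constructor
    · rintro h rfl
      exact h y rfl rfl
    · rintro h z' rfl rfl
      exact h rfl
  | cons a x ih =>
    have ha : a < k := hx a (by simp)
    rw [(aut k c).acc_iff_of_trans_eq (q' := .expect false ⟨a, ha⟩) (by simp [aut])
      (h0.trans (endMarked_cons a x)) (by simp [aut, ha])]
    change (aut k c).Acc (.expect false ⟨a, ha⟩) (setTape t 0 (endMarked x)) ↔ _
    rw [acc_expect (z := z) (by rw [setTape_of_ne _ _ (by decide), h2])]
    have key : ∀ z', (aut k c).Acc (.read false) (setTape (setTape t 0 (endMarked x)) 2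
        (endMarked z')) ↔ z' ≠ x ++ c :: y := fun z' =>
      ih (fun b hb => hx b (by simp [hb])) (by rw [setTape_of_ne _ _ (by decide)]; simp)
        (by rw [setTape_of_ne _ _ (by decide), setTape_of_ne _ _ (by decide), h1]) (by simp)
    simp only [key]
    constructor
    · rintro h rfl
      exact h _ rfl rfl
    · rintro h z' rfl rfl
      exact h rfl

end CatState

/-- Concatenation with a separating letter, on words with letters below `k`. -/
theorem CoRat.cat (k c : ℕ) : CoRat {x : Fin 3 → List ℕ | x 2 = x 0 ++ c :: x 1 ∧
    (∀ a ∈ x 0, a < k) ∧ ∀ a ∈ x 1, a < k} := by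
  have h : CoRat {x : Fin 3 → List ℕ | ¬ (CatState.aut k c).Accepts x} :=
    ⟨_, inferInstance, CatState.aut k c, fun x => Iff.rfl⟩
  convert (h.inter (CoRat.letters 0 (· < k))).inter (CoRat.letters 1 (· < k)) using 1
  ext x
  simp only [Set.mem_ofPred_eq, Set.mem_inter_iff, and_assoc]
  refine and_congr_left fun ⟨h0, h1⟩ => ?_
  simp only [TapeAut.Accepts]
  rw [show (CatState.aut k c).start = {.read false} from rfl]
  have key := CatState.acc_read_false (c := c) h0 h1 (t := fun i => endMarked (x i)) rfl rfl rfl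
  simp [key]

theorem append_cons_inj_of_notMem {α : Type} {h : α} {u u' l l' : List α} (hu : h ∉ u)
    (hu' : h ∉ u') (H : u ++ h :: l = u' ++ h :: l') : u = u' ∧ l = l' := by
  induction u generalizing u' with
  | nil =>
    cases u' with
    | nil => simpa using H
    | cons b u' =>
      simp only [List.nil_append, List.cons_append, List.cons.injEq] at H
      simp [H.1] at hu'
  | cons a u ih =>
    cases u' with
    | nil =>
      simp only [List.nil_append, List.cons_append, List.cons.injEq] at H
      simp [H.1] at hu
    | cons b u' =>
      simp only [List.mem_cons, not_or, List.cons_append, List.cons.injEq] at hu hu' H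
      obtain ⟨h1, h2⟩ := ih hu.2 hu'.2 H.2
      exact ⟨by rw [H.1, h1], h2⟩

/-! ### Block stars -/

/-- Tuples of words with the same number of blocks, separated by the letter `h` on every tape, such
that the tuples of corresponding blocks belong to `S`. -/
inductive BlockStar {ι : Type} (h : ℕ) (S : Set (ι → List ℕ)) : (ι → List ℕ) → Prop
  | single {u} : u ∈ S → BlockStar h S u
  | cons {u T} : u ∈ S → BlockStar h S T → BlockStar h S fun i => u i ++ h :: T i

/-- The states of the automaton recognizing the complement of a block star: skipping a block on the
`j`-th tape, running a given automaton on the current blocks (`D` being the set of tapes whose block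
is exhausted), checking that the numbers of blocks of two tapes differ, checking that another block
follows on a tape, and accepting. -/
inductive StarState (n : ℕ) (ι Q : Type)
  | skip (j : Fin n)
  | run (q : Q) (D : Set ι)
  | mis (i j : ι)
  | has (j : ι)
  -- The argument only supplies a tape for this state to read, as `ι` may be empty.
  | acc (j : ι)

namespace StarState

variable {n : ℕ} {ι Q : Type}

instance [Finite ι] [Finite Q] : Finite (StarState n ι Q) :=
  Finite.of_surjective
    (fun p : Fin n ⊕ (Q × Set ι) ⊕ (ι × ι) ⊕ ι ⊕ ι => match p with
      | .inl j => .skip j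
      | .inr (.inl (q, D)) => .run q D
      | .inr (.inr (.inl (i, j))) => .mis i j
      | .inr (.inr (.inr (.inl j))) => .has j
      | .inr (.inr (.inr (.inr j))) => .acc j)
    (by
      rintro (j | ⟨q, D⟩ | ⟨i, j⟩ | j | j)
      · exact ⟨.inl j, rfl⟩
      · exact ⟨.inr (.inl (q, D)), rfl⟩
      · exact ⟨.inr (.inr (.inl (i, j))), rfl⟩
      · exact ⟨.inr (.inr (.inr (.inl j))), rfl⟩
      · exact ⟨.inr (.inr (.inr (.inr j))), rfl⟩)

/-- The states in which the automaton is at the beginning of a block on every tape. -/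
def round (n : ℕ) (A : TapeAut ι ℕ Q) : Set (StarState n ι Q) :=
  {st | (∃ j : Fin n, j.val = 0 ∧ st = .skip j) ∨ (∃ q ∈ A.start, st = .run q ∅) ∨
    ∃ i j, st = .mis i j}

/-- The states that follow after a block on the `j`-th tape has been skipped. -/
def next (n : ℕ) (A : TapeAut ι ℕ Q) (j : ℕ) : Set (StarState n ι Q) :=
  {st | (∃ j' : Fin n, j'.val = j ∧ st = .skip j') ∨ (j = n ∧ st ∈ round n A)}

/-- The automaton recognizing the complement of the block star of the complement of the language
of `A`. -/
def aut (e : Fin n ≃ ι) (h : ℕ) (A : TapeAut ι ℕ Q) : TapeAut ι ℕ (StarState n ι Q) where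
  tape
    | .skip j => e j
    | .run q _ => A.tape q
    | .mis i _ => i
    | .has j => j
    | .acc j => j
  trans
    | .skip j, s => {st | (s = some h ∧ st ∈ next n A (j.val + 1)) ∨
        ∃ a, a ≠ h ∧ s = some a ∧ st = .skip j}
    -- The separator is presented to `A` as an end marker. Recording the tape in `D` then blocks
    -- further reading there, so the simulation cannot run on into the next block.
    | .run q D, s => {st | A.tape q ∉ D ∧
        (((s = none ∨ s = some h) ∧ ∃ q' ∈ A.trans q none, st = .run q' (insert (A.tape q) D)) ∨
          ∃ a, a ≠ h ∧ s = some a ∧ ∃ q' ∈ A.trans q s, st = .run q' D)}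
    | .mis i j, s => {st | (s = none ∧ st = .has j) ∨ ∃ a, a ≠ h ∧ s = some a ∧ st = .mis i j}
    | .has j, s => {st | (s = some h ∧ st = .acc j) ∨ ∃ a, a ≠ h ∧ s = some a ∧ st = .has j}
    | .acc _, _ => ∅
  start := round n A
  accept := {st | (∃ j, st = .acc j) ∨ ∃ q ∈ A.accept, ∃ D, st = .run q D}

variable {e : Fin n ≃ ι} {h : ℕ} {A : TapeAut ι ℕ Q}

theorem acc_acc (j : ι) (t : ι → List (Option ℕ)) : (aut e h A).Acc (.acc j) t :=
  .done (.inl ⟨j, rfl⟩)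

theorem acc_has {j : ι} {t : ι → List (Option ℕ)} {l : List ℕ} (hl : t j = endMarked l) :
    (aut e h A).Acc (.has j) t ↔ h ∈ l := by
  have hq : StarState.has j ∉ (aut e h A).accept := by simp [aut]
  induction l generalizing t with
  | nil => rw [(aut e h A).acc_iff_of_cons hq hl]; simp [aut]
  | cons a l ih =>
    have hl' := hl.trans (endMarked_cons a l)
    by_cases ha : a = h
    · rw [(aut e h A).acc_iff_of_trans_eq (q' := .acc j) hq hl' (by ext; simp [aut, ha])]
      simp [acc_acc, ha]
    · rw [(aut e h A).acc_iff_of_trans_eq (q' := .has j) hq hl' (by ext; simp [aut, ha])]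
      change (aut e h A).Acc (.has j) (setTape t j (endMarked l)) ↔ _
      refine (ih (t := setTape t j (endMarked l)) (by simp)).trans ?_
      simp [Ne.symm ha]

theorem acc_mis {i j : ι} {t : ι → List (Option ℕ)} {l : List ℕ} (hl : t i = endMarked l) :
    (aut e h A).Acc (.mis i j) t ↔ h ∉ l ∧ (aut e h A).Acc (.has j) (setTape t i []) := by
  have hq : StarState.mis i j ∉ (aut e h A).accept := by simp [aut]
  induction l generalizing t with
  | nil =>
    rw [(aut e h A).acc_iff_of_trans_eq (q' := .has j) hq hl (by ext; simp [aut])]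
    simp [aut]
  | cons a l ih =>
    have hl' := hl.trans (endMarked_cons a l)
    by_cases ha : a = h
    · rw [(aut e h A).acc_iff_of_cons hq hl']
      simp [aut, ha]
    · rw [(aut e h A).acc_iff_of_trans_eq (q' := .mis i j) hq hl' (by ext; simp [aut, ha])]
      change (aut e h A).Acc (.mis i j) (setTape t i (endMarked l)) ↔ _
      refine (ih (t := setTape t i (endMarked l)) (by simp)).trans ?_
      simp [Ne.symm ha]

/-- For `i = j` both sides fail: the head has exhausted the tape when the search for a separator
starts. -/
theorem acc_mis_iff {i j : ι} {T : ι → List ℕ} :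
    (aut e h A).Acc (.mis i j) (fun i => endMarked (T i)) ↔ h ∉ T i ∧ h ∈ T j := by
  rw [acc_mis (t := fun i => endMarked (T i)) rfl]
  refine and_congr_right fun hi => ?_
  by_cases hij : j = i
  · subst hij
    simp only [hi, iff_false]
    exact TapeAut.not_acc_of_nil _ (by simp [aut]) (by simp [aut])
  · exact acc_has (setTape_of_ne _ _ hij)

theorem acc_skip {j : Fin n} {t : ι → List (Option ℕ)} {l : List ℕ}
    (hl : t (e j) = endMarked l) :
    (aut e h A).Acc (.skip j) t ↔ ∃ u l', l = u ++ h :: l' ∧ h ∉ u ∧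
      ∃ st ∈ next n A (j.val + 1), (aut e h A).Acc st (setTape t (e j) (endMarked l')) := by
  have hq : StarState.skip j ∉ (aut e h A).accept := by simp [aut]
  induction l generalizing t with
  | nil => rw [(aut e h A).acc_iff_of_cons hq hl]; simp [aut]
  | cons a l ih =>
    have hl' := hl.trans (endMarked_cons a l)
    by_cases ha : a = h
    · subst ha
      rw [(aut e a A).acc_iff_of_cons hq hl']
      have : (aut e a A).trans (.skip j) (some a) = next n A (j.val + 1) := by
        ext; simp [aut]
      rw [this]
      constructor
      · intro H
        exact ⟨[], l, rfl, by simp, H⟩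
      · rintro ⟨u, l', h1, h2, H⟩
        cases u with
        | nil =>
          simp only [List.nil_append, List.cons.injEq, true_and] at h1
          exact h1 ▸ H
        | cons b u =>
          simp only [List.cons_append, List.cons.injEq] at h1
          simp [h1.1] at h2
    · rw [(aut e h A).acc_iff_of_trans_eq (q' := .skip j) hq hl' (by ext; simp [aut, ha])]
      change (aut e h A).Acc (.skip j) (setTape t (e j) (endMarked l)) ↔ _
      refine (ih (t := setTape t (e j) (endMarked l)) (by simp)).trans ?_
      simp only [setTape_setTape]
      constructor
      · rintro ⟨u, l', h1, h2, H⟩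
        exact ⟨a :: u, l', by simp [h1], by simp [h2, Ne.symm ha], H⟩
      · rintro ⟨u, l', h1, h2, H⟩
        cases u with
        | nil =>
          simp only [List.nil_append, List.cons.injEq] at h1
          exact absurd h1.1 ha
        | cons b u =>
          simp only [List.cons_append, List.cons.injEq] at h1
          exact ⟨u, l', h1.2, fun hu => h2 (by simp [hu]), H⟩

/-- The tapes `t₀` hold the current blocks of the tapes `t`; the blocks of the tapes in `D` are
exhausted. -/
def RunRel (h : ℕ) (D : Set ι) (t₀ t : ι → List (Option ℕ)) : Prop :=
  ∀ i, (i ∈ D → t₀ i = []) ∧ (i ∉ D → ∃ u s r, h ∉ u ∧ t₀ i = endMarked u ∧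
    t i = u.map some ++ s :: r ∧ (s = none ∨ s = some h))

theorem RunRel.finish {D : Set ι} {t₀ t : ι → List (Option ℕ)} (H : RunRel h D t₀ t) (i : ι)
    (y : List (Option ℕ)) : RunRel h (insert i D) (setTape t₀ i []) (setTape t i y) := by
  intro j
  by_cases hj : j = i
  · subst hj; simp
  · simpa [setTape_of_ne _ _ hj, hj] using H j

theorem RunRel.advance {D : Set ι} {t₀ t : ι → List (Option ℕ)} (H : RunRel h D t₀ t) {i : ι}
    (hi : i ∉ D) {u : List ℕ} (hu : h ∉ u) (s r) (hs : s = none ∨ s = some h) :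
    RunRel h D (setTape t₀ i (endMarked u)) (setTape t i (u.map some ++ s :: r)) := by
  intro j
  by_cases hj : j = i
  · subst hj
    refine ⟨fun h => absurd h hi, fun _ => ⟨u, s, r, hu, by simp, by simp, hs⟩⟩
  · simpa [setTape_of_ne _ _ hj] using H j

/-- `RunRel` is an invariant of the simulation: each move of one automaton is matched by a move of
the other, and reading the end marker of a block corresponds to enlarging `D`. -/
theorem acc_run {q : Q} {D : Set ι} {t₀ t : ι → List (Option ℕ)} (H : RunRel h D t₀ t) :
    (aut e h A).Acc (.run q D) t ↔ A.Acc q t₀ := by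
  constructor
  · intro hacc
    generalize hst : StarState.run q D = st at hacc
    induction hacc generalizing q D t₀ with
    | done hq =>
      subst hst
      exact .done (by simpa [aut] using hq)
    | @step st t s y st' h1 h2 h3 ih =>
      subst hst
      obtain ⟨hD, h2⟩ := h2
      obtain ⟨u, s', r, hu, h4, h5, h6⟩ := (H (A.tape q)).2 hD
      change t (A.tape q) = _ at h1
      rw [h1] at h5
      cases u with
      | nil =>
        simp only [List.map_nil, List.nil_append, List.cons.injEq] at h5
        rcases h2 with ⟨-, q', hq', rfl⟩ | ⟨a, ha, hs, -⟩
        · exact .step h4 hq' (ih (H.finish _ _) rfl)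
        · rw [← h5.1, hs] at h6
          simp [ha] at h6
      | cons a u =>
        simp only [List.map_cons, List.cons_append, List.cons.injEq] at h5
        simp only [List.mem_cons, not_or] at hu
        obtain ⟨rfl, rfl⟩ := h5
        rcases h2 with ⟨hs, -⟩ | ⟨b, hb, hs, q', hq', rfl⟩
        · simp [Ne.symm hu.1] at hs
        · exact .step (h4.trans (endMarked_cons a u)) hq'
            (ih (H.advance hD hu.2 _ _ h6) rfl)
  · intro hacc
    induction hacc generalizing D t with
    | @done q t₀ hq => exact .done (.inr ⟨q, hq, D, rfl⟩)
    | @step q t₀ s y q' h1 h2 h3 ih =>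
      have hD : A.tape q ∉ D := fun hD => by simp [(H _).1 hD] at h1
      obtain ⟨u, s', r, hu, h4, h5, h6⟩ := (H (A.tape q)).2 hD
      rw [h1] at h4
      cases u with
      | nil =>
        simp only [endMarked_nil, List.cons.injEq] at h4
        obtain ⟨rfl, rfl⟩ := h4
        exact .step (A := aut e h A) (q := .run q D) h5 ⟨hD, .inl ⟨h6, q', h2, rfl⟩⟩
          (ih (H.finish _ _))
      | cons a u =>
        simp only [endMarked_cons, List.cons.injEq] at h4
        obtain ⟨rfl, rfl⟩ := h4
        simp only [List.mem_cons, not_or] at hu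
        exact .step (A := aut e h A) (q := .run q D) h5
          ⟨hD, .inr ⟨a, Ne.symm hu.1, rfl, q', h2, rfl⟩⟩ (ih (H.advance hD hu.2 _ _ h6))

/-- Skipping one block on every tape. -/
theorem acc_skip_all {u T : ι → List ℕ} (hu : ∀ i, h ∉ u i) (j : Fin n) (hj : j.val = 0) :
    (aut e h A).Acc (.skip j) (fun i => endMarked (u i ++ h :: T i)) ↔
      ∃ st ∈ round n A, (aut e h A).Acc st fun i => endMarked (T i) := by
  -- The tape contents after the block has been skipped on the first `m` tapes in the order given by
  -- `e`.
  let t : ℕ → ι → List (Option ℕ) := fun m i =>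
    if (e.symm i).val < m then endMarked (T i) else endMarked (u i ++ h :: T i)
  have step : ∀ j : Fin n, (aut e h A).Acc (.skip j) (t j) ↔
      ∃ st ∈ next n A (j.val + 1), (aut e h A).Acc st (t (j.val + 1)) := by
    intro j
    have ht : setTape (t j) (e j) (endMarked (T (e j))) = t (j.val + 1) := by
      funext i
      by_cases hi : i = e j
      · subst hi; simp [t]
      · rw [setTape_of_ne _ _ hi]
        have : (e.symm i).val ≠ j.val := fun h => hi (by simp [← Fin.ext h])
        have : (e.symm i).val < j.val ↔ (e.symm i).val < j.val + 1 := by omega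
        simp [t, this]
    rw [acc_skip (l := u (e j) ++ h :: T (e j)) (by simp [t])]
    constructor
    · rintro ⟨u', l', h1, h2, H⟩
      obtain rfl : T (e j) = l' := (append_cons_inj_of_notMem (hu _) h2 h1).2
      rwa [ht] at H
    · intro H
      exact ⟨_, _, rfl, hu _, by rwa [ht]⟩
  have all : ∀ d : ℕ, ∀ j : Fin n, n = j.val + 1 + d → ((aut e h A).Acc (.skip j) (t j) ↔
      ∃ st ∈ round n A, (aut e h A).Acc st (t n)) := by
    intro d
    induction d with
    | zero =>
      intro j hj
      rw [step, show j.val + 1 = n by omega]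
      have : next n A n = round n A := by
        ext st
        simp only [next, Set.mem_ofPred_eq, true_and, or_iff_right_iff_imp]
        rintro ⟨j', h, -⟩
        omega
      rw [this]
    | succ d ih =>
      intro j hj
      rw [step]
      have : next n A (j.val + 1) = {.skip ⟨j.val + 1, by omega⟩} := by
        ext st
        simp only [next, Set.mem_ofPred_eq, Set.mem_singleton_iff]
        constructor
        · rintro (⟨j', h, rfl⟩ | ⟨h, -⟩)
          · congr 1; exact Fin.ext h
          · omega
        · rintro rfl
          exact .inl ⟨_, rfl, rfl⟩
      rw [this, ← ih ⟨j.val + 1, by omega⟩ (by simp; omega)]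
      simp
  have h0 : t j = fun i => endMarked (u i ++ h :: T i) := by funext i; simp [t, hj]
  have hn : t n = fun i => endMarked (T i) := by funext i; simp [t]
  have := j.isLt
  rw [← h0, ← hn]
  exact all (n - 1) j (by omega)

theorem acc_run_blocks {u t : ι → List ℕ} (hu : ∀ i, h ∉ u i)
    (ht : ∀ i, t i = u i ∨ ∃ T, t i = u i ++ h :: T) (q : Q) :
    (aut e h A).Acc (.run q ∅) (fun i => endMarked (t i)) ↔ A.Acc q fun i => endMarked (u i) := by
  refine acc_run fun i => ⟨by simp, fun _ => ?_⟩
  rcases ht i with h1 | ⟨T, h1⟩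
  · exact ⟨u i, none, [], hu i, rfl, by simp [h1, endMarked], .inl rfl⟩
  · exact ⟨u i, some h, endMarked T, hu i, rfl, by simp [h1, endMarked], .inr rfl⟩

end StarState

/-- A tuple fails to be in the block star exactly if, after skipping some number of complete rounds
of blocks, either the current blocks do not form a tuple of `S`, or one tape is in its last block
while another is not. The automaton guesses the round and the kind of error. Since `h` does not
occur in tuples of `S`, the division into blocks is forced. -/
theorem CoRat.blockStar {ι : Type} [Finite ι] {S : Set (ι → List ℕ)} (hS : CoRat S) (h : ℕ)
    (hh : ∀ x ∈ S, ∀ i, h ∉ x i) : CoRat {T | BlockStar h S T} := by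
  obtain ⟨Q, hQ, A, hA⟩ := hS
  obtain ⟨n, ⟨e⟩⟩ := Finite.exists_equiv_fin ι
  refine ⟨_, inferInstance, StarState.aut e.symm h A, fun T => ?_⟩
  change BlockStar h S T ↔ ¬ ∃ st ∈ StarState.round n A, _
  constructor
  · intro hT
    induction hT with
    | @single u hu =>
      rintro ⟨st, ⟨j, hj, rfl⟩ | ⟨q, hq, rfl⟩ | ⟨i, j, rfl⟩, hacc⟩
      · rw [StarState.acc_skip (t := fun i => endMarked (u i)) rfl] at hacc
        obtain ⟨v, l, h1, -⟩ := hacc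
        exact hh u hu (e.symm j) (by simp [h1])
      · rw [StarState.acc_run_blocks (hh u hu) (fun i => .inl rfl)] at hacc
        exact (hA u).1 hu ⟨q, hq, hacc⟩
      · exact hh u hu _ (StarState.acc_mis_iff.1 hacc).2
    | @cons u T hu hT ih =>
      rintro ⟨st, ⟨j, hj, rfl⟩ | ⟨q, hq, rfl⟩ | ⟨i, j, rfl⟩, hacc⟩
      · exact ih ((StarState.acc_skip_all (hh u hu) j hj).1 hacc)
      · rw [StarState.acc_run_blocks (hh u hu) (fun i => .inr ⟨_, rfl⟩)] at hacc
        exact (hA u).1 hu ⟨q, hq, hacc⟩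
      · exact (StarState.acc_mis_iff.1 hacc).1 (by simp)
  · intro hT
    by_contra hstar
    refine hT ?_
    by_cases hnone : ∀ i, h ∉ T i
    · have hTS : T ∉ S := fun hTS => hstar (.single hTS)
      rw [hA, not_not] at hTS
      obtain ⟨q, hq, hacc⟩ := hTS
      exact ⟨.run q ∅, .inr (.inl ⟨q, hq, rfl⟩),
        (StarState.acc_run_blocks hnone (fun i => .inl rfl) q).2 hacc⟩
    push Not at hnone
    obtain ⟨i₀, hi₀⟩ := hnone
    clear hT
    -- The tape `i₀` still contains a separator, so removing its first block shortens it; its length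
    -- serves as the measure for the number of rounds.
    induction hN : (T i₀).length using Nat.strong_induction_on generalizing T with
    | _ N ih =>
    by_cases hall : ∀ i, h ∈ T i
    swap
    · push Not at hall
      obtain ⟨i, hi⟩ := hall
      exact ⟨.mis i i₀, .inr (.inr ⟨_, _, rfl⟩), StarState.acc_mis_iff.2 ⟨hi, hi₀⟩⟩
    have hsplit : ∀ i, ∃ u T', T i = u ++ h :: T' ∧ h ∉ u := fun i => by
      obtain ⟨u, T', h1, h2⟩ := List.eq_append_cons_of_mem (hall i)
      exact ⟨u, T', h1, h2⟩
    choose u T' hT hu using hsplit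
    obtain rfl : T = fun i => u i ++ h :: T' i := funext hT
    by_cases huS : u ∈ S
    swap
    · rw [hA, not_not] at huS
      obtain ⟨q, hq, hacc⟩ := huS
      exact ⟨.run q ∅, .inr (.inl ⟨q, hq, rfl⟩),
        (StarState.acc_run_blocks hu (fun i => .inr ⟨_, rfl⟩) q).2 hacc⟩
    have hT' : ¬ BlockStar h S T' := fun hT' => hstar (.cons huS hT')
    have hn : 0 < n := (e i₀).pos
    refine ⟨.skip ⟨0, hn⟩, .inl ⟨_, rfl, rfl⟩, ?_⟩
    rw [StarState.acc_skip_all hu _ rfl]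
    by_cases h0 : h ∈ T' i₀
    · exact ih _ (by simp only [← hN, List.length_append, List.length_cons]; omega) T' hT' h0 rfl
    by_cases hnone : ∀ i, h ∉ T' i
    · have hTS : T' ∉ S := fun hTS => hT' (.single hTS)
      rw [hA, not_not] at hTS
      obtain ⟨q, hq, hacc⟩ := hTS
      exact ⟨.run q ∅, .inr (.inl ⟨q, hq, rfl⟩),
        (StarState.acc_run_blocks hnone (fun i => .inl rfl) q).2 hacc⟩
    · push Not at hnone
      obtain ⟨i, hi⟩ := hnone
      exact ⟨.mis i₀ i, .inr (.inr ⟨_, _, rfl⟩), StarState.acc_mis_iff.2 ⟨h0, hi⟩⟩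

/-! ### Projections of co-rational sets -/

/-- Relations on words that are projections of relations with rational complement, along tapes
with a bounded alphabet. -/
def ProjCoRat {ι : Type} (P : (ι → List ℕ) → Prop) : Prop :=
  ∃ (κ : Type) (_ : Finite κ) (k : ℕ) (S : Set (ι ⊕ κ → List ℕ)), CoRat S ∧
    (∀ x ∈ S, ∀ j, ∀ c ∈ x (.inr j), c < k) ∧ ∀ x, P x ↔ ∃ w, Sum.elim x w ∈ S

namespace ProjCoRat

variable {ι ι' : Type}

theorem congr {P P' : (ι → List ℕ) → Prop} (h : ProjCoRat P) (H : ∀ x, P' x ↔ P x) :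
    ProjCoRat P' := by
  rwa [show P' = P from funext fun x => propext (H x)]

theorem of_coRat {P : (ι → List ℕ) → Prop} (h : CoRat {x | P x}) : ProjCoRat P := by
  refine ⟨Empty, inferInstance, 0, _, h.comap_injective Sum.inl Sum.inl_injective, ?_, ?_⟩
  · rintro x - ⟨⟩
  · intro x
    exact ⟨fun h => ⟨Empty.elim, h⟩, fun ⟨_, h⟩ => h⟩

/-- Each conjunct keeps its own hidden tapes, so the witnesses can be chosen independently. -/
theorem all {J : Type} [Finite J] {P : J → (ι → List ℕ) → Prop}
    (h : ∀ j, ProjCoRat (P j)) : ProjCoRat fun x => ∀ j, P j x := by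
  choose κ hκ k S hS hk hP using h
  obtain ⟨K, hK⟩ := (Set.finite_range k).bddAbove
  let ρ : ∀ j, ι ⊕ κ j → ι ⊕ Σ j, κ j := fun j => Sum.map id (Sigma.mk j)
  have hρ : ∀ j, Function.Injective (ρ j) := fun j =>
    Function.Injective.sumMap Function.injective_id sigma_mk_injective
  refine ⟨Σ j, κ j, inferInstance, K, _,
    CoRat.iInter fun j => (hS j).comap_injective (ρ j) (hρ j), ?_, ?_⟩
  · rintro x hx ⟨j, i⟩ c hc
    exact (hk j _ (hx j) i c hc).trans_le (hK ⟨j, rfl⟩)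
  · intro x
    simp only [hP]
    constructor
    · intro H
      choose w hw using H
      refine ⟨fun p => w p.1 p.2, fun j => Set.mem_of_eq_of_mem (s := S j) ?_ (hw j)⟩
      funext i
      rcases i with i | i <;> rfl
    · rintro ⟨w, hw⟩ j
      refine ⟨fun i => w ⟨j, i⟩, Set.mem_of_eq_of_mem (s := S j) ?_ (hw j)⟩
      funext i
      rcases i with i | i <;> rfl

protected theorem and {P P' : (ι → List ℕ) → Prop} (h : ProjCoRat P) (h' : ProjCoRat P') :
    ProjCoRat fun x => P x ∧ P' x := by
  have := ProjCoRat.all (J := Bool) (P := fun b => cond b P P') (by rintro (_ | _) <;> assumption)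
  exact this.congr fun x => by simp [and_comm]

theorem comap_injective {P : (ι → List ℕ) → Prop} (h : ProjCoRat P) (ρ : ι → ι')
    (hρ : Function.Injective ρ) : ProjCoRat fun x : ι' → List ℕ => P fun i => x (ρ i) := by
  obtain ⟨κ, hκ, k, S, hS, hk, hP⟩ := h
  refine ⟨κ, hκ, k, _, hS.comap_injective (Sum.map ρ id)
    (Function.Injective.sumMap hρ Function.injective_id), fun x hx j => hk _ hx j, fun x => ?_⟩
  refine (hP _).trans (exists_congr fun w => ?_)
  have : (fun i => Sum.elim x w (Sum.map ρ id i)) = Sum.elim (fun i => x (ρ i)) w := by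
    funext i
    rcases i with i | i <;> rfl
  rw [Set.mem_ofPred_eq, this]

theorem ex {κ : Type} [Finite κ] {P : (ι ⊕ κ → List ℕ) → Prop} (h : ProjCoRat P)
    (k : ℕ) (hb : ∀ x, P x → ∀ j, ∀ c ∈ x (.inr j), c < k) :
    ProjCoRat fun x : ι → List ℕ => ∃ w, P (Sum.elim x w) := by
  obtain ⟨κ', hκ', k', S, hS, hk, hP⟩ := h
  refine ⟨κ ⊕ κ', inferInstance, max k k', _, hS.comap_injective (Equiv.sumAssoc ι κ κ')
    (Equiv.injective _), ?_, fun x => ?_⟩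
  · rintro x hx (j | j) c hc
    · refine lt_max_of_lt_left (hb (fun i => x (Equiv.sumAssoc ι κ κ' (.inl i)))
        ((hP _).2 ⟨fun i => x (.inr (.inr i)), ?_⟩) j c hc)
      convert Set.mem_ofPred_eq ▸ hx using 1
      funext i
      rcases i with i | i <;> rfl
    · exact lt_max_of_lt_right (hk _ hx j c hc)
  · simp only [hP]
    constructor
    · rintro ⟨w, w', H⟩
      refine ⟨Sum.elim w w', Set.mem_of_eq_of_mem (s := S) ?_ H⟩
      funext i
      rcases i with (i | i) | i <;> rfl
    · rintro ⟨w, H⟩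
      refine ⟨fun i => w (.inl i), fun i => w (.inr i), Set.mem_of_eq_of_mem (s := S) ?_ H⟩
      funext i
      rcases i with (i | i) | i <;> rfl

theorem letters (i : ι) (P : ℕ → Prop) : ProjCoRat fun x : ι → List ℕ => ∀ c ∈ x i, P c :=
  of_coRat (CoRat.letters i P)

theorem cat (k c : ℕ) {i j l : ι} (hij : i ≠ j) (hil : i ≠ l) (hjl : j ≠ l) :
    ProjCoRat fun x : ι → List ℕ => x l = x i ++ c :: x j ∧
      (∀ a ∈ x i, a < k) ∧ ∀ a ∈ x j, a < k :=
  (of_coRat (CoRat.cat k c)).comap_injective ![i, j, l] (by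
    intro a b
    fin_cases a <;> fin_cases b <;> simp [*, Ne.symm hij, Ne.symm hil, Ne.symm hjl])

/-- Two words agree if prefixing both by the same separator gives one common word. The two hidden
tapes hold the empty word and this common word, which reduces equality to `cat`. -/
protected theorem eq (k : ℕ) (i j : ι) :
    ProjCoRat fun x : ι → List ℕ => x i = x j ∧ ∀ a ∈ x i, a < k := by
  have h := ((((letters (.inr 0) fun _ => False).and
    (cat (ι := ι ⊕ Fin 2) (k + 1) 0 (i := .inr 0) (j := .inl i) (l := .inr 1)
      (by simp) (by simp) (by simp))).and
    (cat (ι := ι ⊕ Fin 2) (k + 1) 0 (i := .inr 0) (j := .inl j) (l := .inr 1)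
      (by simp) (by simp) (by simp))).and (letters (.inl i) (· < k))).ex (k + 1) ?_
  · refine h.congr fun x => ?_
    constructor
    · rintro ⟨h1, h2⟩
      refine ⟨![[], 0 :: x i], ?_⟩
      have h3 : ∀ a ∈ x j, a < k := h1 ▸ h2
      have h4 : ∀ a ∈ x j, a ≤ k := fun a ha => (h3 a ha).le
      simpa [h1] using ⟨h4, h3⟩
    · rintro ⟨w, ⟨⟨h1, h2, -⟩, h3, -⟩, h4⟩
      have h1' : w 0 = [] := List.eq_nil_iff_forall_not_mem.2 h1
      simp_all
  · rintro x ⟨⟨⟨h1, h2, h3, h4⟩, -⟩, -⟩ l c hc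
    fin_cases l
    · exact (h1 c hc).elim
    · change c ∈ x (.inr 1) at hc
      rw [h2] at hc
      simp only [List.mem_append, List.mem_cons] at hc
      rcases hc with hc | rfl | hc
      · exact h3 c hc
      · omega
      · exact h4 c hc

/-- When `ρ` identifies indices, every argument gets a fresh tape that is tied to the prescribed one
by `ProjCoRat.eq`, and the copies are quantified away. The bound on the letters is needed for both
operations. -/
theorem comap [Finite ι] {P : (ι → List ℕ) → Prop} (h : ProjCoRat P) (k : ℕ)
    (hb : ∀ x, P x → ∀ i, ∀ c ∈ x i, c < k) (ρ : ι → ι') :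
    ProjCoRat fun x : ι' → List ℕ => P fun i => x (ρ i) := by
  have h' := ((h.comap_injective (ι' := ι' ⊕ ι) .inr Sum.inr_injective).and
    (ProjCoRat.all fun i : ι => ProjCoRat.eq k (.inr i : ι' ⊕ ι) (.inl (ρ i)))).ex k fun x hx j => hb _ hx.1 j
  refine h'.congr fun x => ?_
  constructor
  · intro hP
    exact ⟨fun i => x (ρ i), hP, fun i => ⟨rfl, hb _ hP i⟩⟩
  · rintro ⟨w, h1, h2⟩
    convert h1 using 1
    funext i
    exact (h2 i).1.symm

/-- Projection commutes with the block star: hidden words are chosen block by block and joined by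
the same separator. The separator is `max k k'` so that it differs from the letters of visible and
hidden tapes alike. -/
theorem blockStar [Finite ι] {P : (ι → List ℕ) → Prop} (h : ProjCoRat P) (k : ℕ)
    (hb : ∀ x, P x → ∀ i, ∀ c ∈ x i, c < k) :
    ∃ l, k ≤ l ∧ ProjCoRat fun x => BlockStar l {x | P x} x := by
  obtain ⟨κ, hκ, k', S, hS, hk, hP⟩ := h
  have hSP : ∀ x ∈ S, P fun i => x (.inl i) := fun x hx => by
    refine (hP _).2 ⟨fun i => x (.inr i), ?_⟩
    convert hx using 1
    funext i
    rcases i with i | i <;> rfl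
  refine ⟨max k k', le_max_left _ _, κ, hκ, max k k' + 1, _, hS.blockStar (max k k') ?_, ?_, ?_⟩
  · rintro x hx (i | i) hc
    · have := hb _ (hSP x hx) i _ hc
      omega
    · have := hk _ hx i _ hc
      omega
  · intro x hx j
    replace hx : BlockStar _ _ x := hx
    induction hx with
    | single hu =>
      intro c hc
      have := hk _ hu j c hc
      omega
    | cons hu hT ih =>
      intro c hc
      simp only [List.mem_append, List.mem_cons] at hc
      rcases hc with hc | rfl | hc
      · have := hk _ hu j c hc
        omega
      · omega
      · exact ih c hc
  · intro x
    constructor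
    · intro hx
      induction hx with
      | single hu =>
        obtain ⟨w, hw⟩ := (hP _).1 hu
        exact ⟨w, .single hw⟩
      | @cons u T hu hT ih =>
        obtain ⟨w, hw⟩ := (hP _).1 hu
        obtain ⟨w', hw'⟩ := ih
        refine ⟨fun i => w i ++ max k k' :: w' i,
          Set.mem_of_eq_of_mem (s := {T | BlockStar (max k k') S T}) ?_ (BlockStar.cons hw hw')⟩
        funext i
        rcases i with i | i <;> rfl
    · rintro ⟨w, hw⟩
      suffices ∀ y, BlockStar (max k k') S y → BlockStar (max k k') {x | P x} fun i => y (.inl i)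
        from this _ hw
      intro y hy
      induction hy with
      | single hu => exact .single (hSP _ hu)
      | cons hu _ ih => exact .cons (hSP _ hu) ih

end ProjCoRat

/-! ### Representable relations on natural numbers -/

/-- Numbers in unary notation. -/
def unary {ι : Type} (v : ι → ℕ) : ι → List ℕ := fun i => List.replicate (v i) 0

section unary
variable {ι : Type}

theorem unary_injective : Function.Injective (unary : (ι → ℕ) → _) := by
  intro v w h
  funext i
  have := congrArg List.length (congrFun h i)
  simpa [unary] using this

theorem eq_zero_of_mem_unary {v : ι → ℕ} {i : ι} {c : ℕ} (h : c ∈ unary v i) : c = 0 :=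
  (List.mem_replicate.1 h).2

theorem exists_eq_unary_iff {x : ι → List ℕ} :
    (∃ v, x = unary v) ↔ ∀ i, ∀ c ∈ x i, c = 0 := by
  constructor
  · rintro ⟨v, rfl⟩ i c hc
    exact eq_zero_of_mem_unary hc
  · intro h
    refine ⟨fun i => (x i).length, funext fun i => ?_⟩
    exact List.eq_replicate_iff.2 ⟨rfl, h i⟩

end unary

/-- Relations on natural numbers that, in unary notation, are projections of relations with
rational complement. -/
def Representable {ι : Type} (P : (ι → ℕ) → Prop) : Prop :=
  ProjCoRat fun x => ∃ v, P v ∧ x = unary v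

namespace Representable

variable {ι ι' : Type}

theorem congr {P P' : (ι → ℕ) → Prop} (h : Representable P) (H : ∀ v, P' v ↔ P v) :
    Representable P' := by
  rwa [show P' = P from funext fun x => propext (H x)]

theorem lt_one {P : (ι → ℕ) → Prop} (x : ι → List ℕ) (hx : ∃ v, P v ∧ x = unary v) (i : ι) :
    ∀ c ∈ x i, c < 1 := by
  obtain ⟨v, -, rfl⟩ := hx
  intro c hc
  simp [eq_zero_of_mem_unary hc]

/-- The relation on numbers induced by a projective relation on words is representable. -/
theorem of_projCoRat [Finite ι] {X : (ι → List ℕ) → Prop} (h : ProjCoRat X) :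
    Representable fun v => X (unary v) := by
  refine (h.and (ProjCoRat.all fun i : ι => ProjCoRat.letters i (· = 0))).congr fun x => ?_
  constructor
  · rintro ⟨v, hv, rfl⟩
    exact ⟨hv, exists_eq_unary_iff.1 ⟨v, rfl⟩⟩
  · rintro ⟨h1, h2⟩
    obtain ⟨v, rfl⟩ := exists_eq_unary_iff.2 h2
    exact ⟨v, h1, rfl⟩

theorem apply_unary_iff {P : (ι → ℕ) → Prop} {v : ι → ℕ} :
    (∃ w, P w ∧ unary v = unary w) ↔ P v := by
  constructor
  · rintro ⟨w, hw, h⟩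
    rwa [unary_injective h]
  · intro h
    exact ⟨v, h, rfl⟩

theorem all [Finite ι] {J : Type} [Finite J] {P : J → (ι → ℕ) → Prop}
    (h : ∀ j, Representable (P j)) : Representable fun v => ∀ j, P j v :=
  (of_projCoRat (ProjCoRat.all h)).congr fun _ => by simp only [apply_unary_iff]

protected theorem and [Finite ι] {P P' : (ι → ℕ) → Prop} (h : Representable P)
    (h' : Representable P') : Representable fun v => P v ∧ P' v :=
  (of_projCoRat (ProjCoRat.and h h')).congr fun _ => by simp only [apply_unary_iff]

theorem comap [Finite ι] [Finite ι'] {P : (ι → ℕ) → Prop} (h : Representable P) (ρ : ι → ι') :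
    Representable fun v : ι' → ℕ => P fun i => v (ρ i) :=
  (of_projCoRat (ProjCoRat.comap h 1 lt_one ρ)).congr fun v =>
    (apply_unary_iff (v := fun i => v (ρ i))).symm

theorem ex [Finite ι] {κ : Type} [Finite κ] {P : (ι → ℕ) → (κ → ℕ) → Prop}
    (h : Representable fun u : ι ⊕ κ → ℕ => P (fun i => u (.inl i)) fun j => u (.inr j)) :
    Representable fun v => ∃ w, P v w := by
  refine (of_projCoRat (ProjCoRat.ex h 1 fun x hx j => lt_one x hx _)).congr fun v => ?_
  constructor
  · rintro ⟨w, hw⟩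
    refine ⟨unary w, Sum.elim v w, hw, ?_⟩
    funext i
    rcases i with i | i <;> rfl
  · rintro ⟨w, u, hu, h⟩
    refine ⟨fun j => u (.inr j), ?_⟩
    rwa [unary_injective (a₁ := v) (a₂ := fun i => u (.inl i))
      (funext fun i => congrFun h (.inl i))]

theorem zero [Finite ι] (i : ι) : Representable fun v : ι → ℕ => v i = 0 :=
  (of_projCoRat (ProjCoRat.letters i fun _ => False)).congr fun v => by simp [unary]

protected theorem eq [Finite ι] (i j : ι) : Representable fun v : ι → ℕ => v i = v j := by
  have h : Representable fun v : Fin 2 → ℕ => v 0 = v 1 :=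
    (of_projCoRat (ProjCoRat.eq 1 (0 : Fin 2) 1)).congr fun v => by
      simp [unary]
  exact h.comap ![i, j]

theorem succ [Finite ι] (i j : ι) : Representable fun v : ι → ℕ => v i = v j + 1 := by
  -- The coordinate `v 0 = 0` supplies the empty word in `x ++ 0 :: y`; the separator is the unary
  -- digit itself and so adds one.
  have h : Representable fun v : Fin 3 → ℕ => v 1 = v 2 + 1 ∧ v 0 = 0 :=
    (of_projCoRat ((ProjCoRat.cat 1 0 (i := (0 : Fin 3)) (j := 2) (l := 1) (by decide) (by decide)
      (by decide)).and (ProjCoRat.letters 0 fun _ => False))).congr fun v => by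
        simp only [unary, List.mem_replicate]
        constructor
        · rintro ⟨h1, h2⟩
          simp [h1, h2, List.replicate_succ]
        · rintro ⟨⟨h1, -⟩, h2⟩
          have h0 : v 0 = 0 := by
            by_contra h
            exact h2 0 ⟨h, rfl⟩
          have := congrArg List.length h1
          simp only [h0, List.replicate_zero, List.nil_append, List.length_replicate,
            List.length_cons] at this
          exact ⟨this, h0⟩
  refine (Representable.ex (κ := Unit) (P := fun v w => v i = v j + 1 ∧ w () = 0)
    (h.comap ![Sum.inr (), Sum.inl i, Sum.inl j])).congr fun v => ?_
  exact ⟨fun h => ⟨fun _ => 0, h, rfl⟩, fun ⟨_, h, _⟩ => h⟩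

/-! ### Transitive closure -/

section transGen

variable {σ : Type} {R : (σ → ℕ) → (σ → ℕ) → Prop}

/-- The encoding of a pair of tuples of numbers related by `R`. -/
abbrev encodedPairs (R : (σ → ℕ) → (σ → ℕ) → Prop) : Set (σ ⊕ σ → List ℕ) :=
  {x | ∃ v, R (fun i => v (.inl i)) (fun i => v (.inr i)) ∧ x = unary v}

/-- Comparing blocks in the equation, the first left component is `a`, each right component equals
the next left component, and the last right component is `b`. Thus the pairs form a chain. The
separator differs from the unary digit 0, so blocks can be compared one at a time. -/
theorem transGen_of_blockStar {l : ℕ} (hl : l ≠ 0) {T : σ ⊕ σ → List ℕ}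
    (hT : BlockStar l (encodedPairs R) T) {a b : σ → ℕ}
    (H : ∀ i, unary a i ++ l :: T (.inr i) = T (.inl i) ++ l :: unary b i) :
    Relation.TransGen R a b := by
  have hmem : ∀ {ι : Type} (v : ι → ℕ) i, l ∉ unary v i := fun v i h => hl (eq_zero_of_mem_unary h)
  induction hT generalizing a with
  | single hu =>
    obtain ⟨v, hR, rfl⟩ := hu
    have h1 := fun i => append_cons_inj_of_notMem (hmem a i) (hmem v (Sum.inl i)) (H i)
    have ha : a = fun i => v (Sum.inl i) := unary_injective (funext fun i => (h1 i).1)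
    have hb : (fun i => v (Sum.inr i)) = b := unary_injective (funext fun i => (h1 i).2)
    rw [← hb, ha]
    exact .single hR
  | @cons u T hu hT ih =>
    obtain ⟨v, hR, rfl⟩ := hu
    simp only [List.append_assoc, List.cons_append] at H
    have h1 := fun i => append_cons_inj_of_notMem (hmem a i) (hmem v (Sum.inl i)) (H i)
    have ha : a = fun i => v (Sum.inl i) := unary_injective (funext fun i => (h1 i).1)
    rw [ha]
    exact .head hR (ih fun i => (h1 i).2)

theorem exists_blockStar_of_transGen (l : ℕ) {a b : σ → ℕ} (h : Relation.TransGen R a b) :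
    ∃ T, BlockStar l (encodedPairs R) T ∧
      ∀ i, unary a i ++ l :: T (.inr i) = T (.inl i) ++ l :: unary b i := by
  induction h using Relation.TransGen.head_induction_on with
  | @single a hR => exact ⟨unary (Sum.elim a b), .single ⟨_, hR, rfl⟩, fun i => rfl⟩
  | @head a c hR _ ih =>
    obtain ⟨T, hT, H⟩ := ih
    refine ⟨_, .cons ⟨Sum.elim a c, hR, rfl⟩ hT, fun i => ?_⟩
    have := H i
    simp only [List.append_assoc, List.cons_append, ← this]
    rfl

theorem transGen [Finite σ]
    (h : Representable fun u : σ ⊕ σ → ℕ => R (fun i => u (.inl i)) fun i => u (.inr i)) :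
    Representable fun u : σ ⊕ σ → ℕ =>
      Relation.TransGen R (fun i => u (.inl i)) fun i => u (.inr i) := by
  obtain ⟨l, hl, hstar⟩ := ProjCoRat.blockStar h 1 lt_one
  have hlt : ∀ T, BlockStar l (encodedPairs R) T → ∀ i, ∀ c ∈ T i, c < l + 1 := by
    intro T hT i
    induction hT with
    | single hu =>
      obtain ⟨v, -, rfl⟩ := hu
      intro c hc
      simp [eq_zero_of_mem_unary hc]
    | cons hu _ ih =>
      obtain ⟨v, -, rfl⟩ := hu
      intro c hc
      simp only [List.mem_append, List.mem_cons] at hc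
      rcases hc with hc | rfl | hc
      · simp [eq_zero_of_mem_unary hc]
      · omega
      · exact ih c hc
  -- Tapes: the given pair `a`, `b`; then the block word `T`, and for each coordinate the common
  -- value of the two sides of the shift equation. The last two groups are quantified away.
  have key := ((hstar.comap_injective (ι' := (σ ⊕ σ) ⊕ ((σ ⊕ σ) ⊕ σ)) (fun s => .inr (.inl s))
      fun a b h => by simpa using h).and (ProjCoRat.all fun i : σ =>
    (ProjCoRat.cat (l + 1) l (i := (.inl (.inl i) : (σ ⊕ σ) ⊕ ((σ ⊕ σ) ⊕ σ)))
      (j := .inr (.inl (.inr i))) (l := .inr (.inr i)) (by simp) (by simp) (by simp)).and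
    (ProjCoRat.cat (l + 1) l (i := (.inr (.inl (.inl i)) : (σ ⊕ σ) ⊕ ((σ ⊕ σ) ⊕ σ)))
      (j := .inl (.inr i)) (l := .inr (.inr i)) (by simp) (by simp) (by simp)))).ex (l + 1) ?_
  · refine (of_projCoRat key).congr fun u => ?_
    have hu : ∀ s, ∀ a ∈ unary u s, a < l + 1 := fun s a ha => by simp [eq_zero_of_mem_unary ha]
    constructor
    · intro htrans
      obtain ⟨T, hT, H⟩ := exists_blockStar_of_transGen l htrans
      refine ⟨Sum.elim T fun i => unary u (.inl i) ++ l :: T (.inr i), hT, fun i => ?_⟩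
      exact ⟨⟨rfl, hu _, hlt T hT _⟩, H i, hlt T hT _, hu _⟩
    · rintro ⟨w, hT, H⟩
      exact transGen_of_blockStar (by omega) hT fun i => (H i).1.1.symm.trans (H i).2.1
  · rintro x ⟨hT, H⟩ (i | i) c hc
    · exact hlt _ hT i c hc
    · obtain ⟨⟨h1, h2, h3⟩, -⟩ := H i
      rw [h1] at hc
      simp only [List.mem_append, List.mem_cons] at hc
      rcases hc with hc | rfl | hc
      · exact h2 c hc
      · omega
      · exact h3 c hc

end transGen

end Representable

/-! ### Graphs of partial recursive functions -/

open List.Vector in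
theorem mem_mOfFn_iff {n : ℕ} {p : Fin n → Part ℕ} {a : List.Vector ℕ n} :
    a ∈ (mOfFn p : Part (List.Vector ℕ n)) ↔ ∀ i, a.get i ∈ p i := by
  induction n with
  | zero =>
    simp only [mOfFn, IsEmpty.forall_iff, iff_true]
    rw [a.eq_nil]
    exact Part.mem_some _
  | succ n ih =>
    simp only [mOfFn, Part.bind_eq_bind, Part.mem_bind_iff, ih, Fin.forall_fin_succ]
    constructor
    · rintro ⟨b, hb, c, hc, h⟩
      obtain rfl := Part.mem_some_iff.1 h
      exact ⟨by simpa using hb, by simpa using hc⟩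
    · rintro ⟨h0, hs⟩
      refine ⟨_, h0, a.tail, fun i => by simpa using hs i, ?_⟩
      refine Part.mem_some_iff.2 ?_
      simp

/-- The graph of a partial function is representable. -/
def RepresentableGraph {n : ℕ} (f : List.Vector ℕ n →. ℕ) : Prop :=
  Representable fun v : Option (Fin n) → ℕ => v none ∈ f (List.Vector.ofFn fun i => v (some i))

namespace RepresentableGraph

variable {ι : Type} [Finite ι] {n m : ℕ}

theorem apply {f : List.Vector ℕ n →. ℕ} (h : RepresentableGraph f) (out : ι) (args : Fin n → ι) :
    Representable fun v : ι → ℕ => v out ∈ f (List.Vector.ofFn fun i => v (args i)) :=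
  Representable.comap h fun o => o.elim out args

theorem comp {f : List.Vector ℕ n →. ℕ} {g : Fin n → List.Vector ℕ m →. ℕ}
    (hf : RepresentableGraph f) (hg : ∀ i, RepresentableGraph (g i)) :
    RepresentableGraph fun v => (List.Vector.mOfFn fun i => g i v) >>= f := by
  have h := (Representable.all fun i => (hg i).apply (ι := Option (Fin m) ⊕ Fin n) (Sum.inr i)
    fun j => Sum.inl (some j)).and (hf.apply (Sum.inl none) Sum.inr)
  refine (Representable.ex (P := fun v w => (∀ i, w i ∈ g i (List.Vector.ofFn fun j => v (some j))) ∧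
    v none ∈ f (List.Vector.ofFn w)) h).congr fun v => ?_
  refine Iff.trans Part.mem_bind_iff ?_
  simp only [mem_mOfFn_iff]
  constructor
  · rintro ⟨a, h1, h2⟩
    exact ⟨a.get, h1, by simpa using h2⟩
  · rintro ⟨w, h1, h2⟩
    exact ⟨List.Vector.ofFn w, by simpa using h1, h2⟩

theorem get (i : Fin n) : RepresentableGraph fun v : List.Vector ℕ n => Part.some (v.get i) :=
  (Representable.eq none (some i)).congr fun v => by simp

theorem zero : RepresentableGraph fun _ : List.Vector ℕ 0 => Part.some 0 :=
  (Representable.zero none).congr fun v => by simp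

theorem succ : RepresentableGraph fun v : List.Vector ℕ 1 => Part.some (v.head + 1) :=
  (Representable.succ none (some 0)).congr fun v => by simp

section prec

variable (f : List.Vector ℕ n → ℕ) (g : List.Vector ℕ (n + 2) → ℕ)

/-- The values of a function defined by primitive recursion. -/
def precValue (v : List.Vector ℕ n) (k : ℕ) : ℕ :=
  k.rec (f v) fun y IH => g (y ::ᵥ IH ::ᵥ v)

/-- One step of a primitive recursion; a state consists of a counter, the previous value, the
current value and the parameters. -/
def PrecStep (s s' : Fin 3 ⊕ Fin n → ℕ) : Prop :=
  s' (Sum.inl 0) = s (Sum.inl 0) + 1 ∧ s' (Sum.inl 1) = s (Sum.inl 2) ∧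
    s' (Sum.inl 2) = g (List.Vector.ofFn fun i : Fin (n + 2) =>
      s (Fin.cases (Sum.inl 0) (Fin.cases (Sum.inl 2) Sum.inr) i)) ∧
    ∀ i, s' (Sum.inr i) = s (Sum.inr i)

variable {f g}

theorem precStep_args (s : Fin 3 ⊕ Fin n → ℕ) :
    (List.Vector.ofFn fun i : Fin (n + 2) => s (Fin.cases (Sum.inl 0) (Fin.cases (Sum.inl 2) Sum.inr) i)) =
      s (Sum.inl 0) ::ᵥ s (Sum.inl 2) ::ᵥ List.Vector.ofFn fun i => s (Sum.inr i) := by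
  simp only [List.Vector.ofFn]
  rfl

/-- `TransGen` makes at least one step, so the value after `k` recursion steps is read off as the
previous value in a state with counter `k + 1`. This covers `k = 0` without a separate case. -/
theorem transGen_precStep {s s' : Fin 3 ⊕ Fin n → ℕ} (h : Relation.TransGen (PrecStep g) s s')
    (h0 : s (Sum.inl 0) = 0) (h2 : s (Sum.inl 2) = f (List.Vector.ofFn fun i => s (Sum.inr i))) :
    (∀ i, s' (Sum.inr i) = s (Sum.inr i)) ∧ ∃ k, s' (Sum.inl 0) = k + 1 ∧
      s' (Sum.inl 1) = precValue f g (List.Vector.ofFn fun i => s (Sum.inr i)) k ∧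
      s' (Sum.inl 2) = precValue f g (List.Vector.ofFn fun i => s (Sum.inr i)) (k + 1) := by
  induction h with
  | single h =>
    obtain ⟨h3, h4, h5, h6⟩ := h
    rw [precStep_args] at h5
    refine ⟨h6, 0, by rw [h3, h0], by rw [h4, h2]; rfl, ?_⟩
    rw [h5, h0, h2]
    rfl
  | tail _ h ih =>
    obtain ⟨h3, h4, h5, h6⟩ := h
    obtain ⟨h7, k, h8, h9, h10⟩ := ih
    rw [precStep_args] at h5
    refine ⟨fun i => (h6 i).trans (h7 i), k + 1, by rw [h3, h8], by rw [h4, h10], ?_⟩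
    simp only [h5, h8, h10, h7]
    rfl

/-- The `k`-th state of a primitive recursion. -/
def precState (f : List.Vector ℕ n → ℕ) (g : List.Vector ℕ (n + 2) → ℕ) (v : Fin n → ℕ) (k : ℕ) :
    Fin 3 ⊕ Fin n → ℕ :=
  -- For `k = 0` the previous value is irrelevant: the first step overwrites it.
  Sum.elim ![k, precValue f g (List.Vector.ofFn v) (k - 1), precValue f g (List.Vector.ofFn v) k] v

theorem transGen_precState (v : Fin n → ℕ) (k : ℕ) :
    Relation.TransGen (PrecStep g) (precState f g v 0) (precState f g v (k + 1)) := by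
  have step : ∀ k, PrecStep g (precState f g v k) (precState f g v (k + 1)) := fun k => by
    refine ⟨rfl, rfl, ?_, fun i => rfl⟩
    rw [precStep_args]
    rfl
  induction k with
  | zero => exact .single (step 0)
  | succ k ih => exact .tail ih (step _)

theorem prec (hf : RepresentableGraph fun v => Part.some (f v))
    (hg : RepresentableGraph fun v => Part.some (g v)) :
    RepresentableGraph fun v : List.Vector ℕ (n + 1) =>
      Part.some (v.head.rec (f v.tail) fun y IH => g (y ::ᵥ IH ::ᵥ v.tail) : ℕ) := by
  let σ := Fin 3 ⊕ Fin n
  have hstep : Representable fun u : σ ⊕ σ → ℕ =>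
      PrecStep g (fun i => u (Sum.inl i)) fun i => u (Sum.inr i) := by
    refine (Representable.succ (Sum.inr (Sum.inl 0)) (Sum.inl (Sum.inl 0))).and
      ((Representable.eq (Sum.inr (Sum.inl 1)) (Sum.inl (Sum.inl 2))).and (Representable.and ?_
        (Representable.all fun i => Representable.eq (Sum.inr (Sum.inr i)) (Sum.inl (Sum.inr i)))))
    exact (hg.apply (ι := σ ⊕ σ) (Sum.inr (Sum.inl 2)) fun i : Fin (n + 2) =>
      Sum.inl (Fin.cases (Sum.inl 0) (Fin.cases (Sum.inl 2) Sum.inr) i)).congr fun v => by simp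
  have htrans := Representable.transGen hstep
  have hf' := (hf.apply (ι := Option (Fin (n + 1)) ⊕ (σ ⊕ σ)) (Sum.inr (Sum.inl (Sum.inl 2))) fun i =>
    Sum.inr (Sum.inl (Sum.inr i)))
  have h := (htrans.comap (ι' := Option (Fin (n + 1)) ⊕ (σ ⊕ σ)) Sum.inr).and
    ((Representable.zero (Sum.inr (Sum.inl (Sum.inl 0)))).and (hf'.and
    ((Representable.all fun i : Fin n =>
      Representable.eq (Sum.inr (Sum.inl (Sum.inr i))) (Sum.inl (some i.succ))).and
    ((Representable.succ (Sum.inr (Sum.inr (Sum.inl 0))) (Sum.inl (some 0))).and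
      (Representable.eq (Sum.inr (Sum.inr (Sum.inl 1))) (Sum.inl none))))))
  refine (Representable.ex (P := fun v w => Relation.TransGen (PrecStep g) (fun i => w (Sum.inl i))
    (fun i => w (Sum.inr i)) ∧ w (Sum.inl (Sum.inl 0)) = 0 ∧
      w (Sum.inl (Sum.inl 2)) ∈ Part.some (f (List.Vector.ofFn fun i => w (Sum.inl (Sum.inr i)))) ∧
      (∀ i : Fin n, w (Sum.inl (Sum.inr i)) = v (some i.succ)) ∧
      w (Sum.inr (Sum.inl 0)) = v (some 0) + 1 ∧ w (Sum.inr (Sum.inl 1)) = v none) h).congr fun v => ?_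
  have htail : (List.Vector.ofFn fun i => v (some i)).tail =
      List.Vector.ofFn fun i : Fin n => v (some i.succ) := by simp [List.Vector.ofFn]
  have hhead : (List.Vector.ofFn fun i => v (some i)).head = v (some 0) := by
    simp [List.Vector.ofFn]
  refine Iff.trans Part.mem_some_iff ?_
  rw [htail, hhead]
  change v none = precValue f g _ _ ↔ _
  constructor
  · intro h
    refine ⟨Sum.elim (precState f g (fun i => v (some i.succ)) 0)
      (precState f g (fun i => v (some i.succ)) (v (some 0) + 1)), transGen_precState _ _, rfl,
      Part.mem_some_iff.2 rfl, fun i => rfl, rfl, h.symm⟩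
  · rintro ⟨w, h1, h2, h3, h4, h5, h6⟩
    obtain ⟨-, k, h7, h8, -⟩ := transGen_precStep h1 h2 (Part.mem_some_iff.1 h3)
    simp only [h4] at h8
    obtain rfl : v (some 0) = k := by omega
    rw [← h6, h8]

end prec

section rfind

variable {f : List.Vector ℕ (n + 1) → ℕ}

/-- One step of an unbounded search; a state consists of a counter, the previous value, which must
not be `0`, and the parameters. -/
def RfindStep (f : List.Vector ℕ (n + 1) → ℕ) (s s' : Fin 2 ⊕ Fin n → ℕ) : Prop :=
  -- Being nonzero is written as being a successor, with a witness indexed by `Unit`, to match the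
  -- form of `Representable.ex`.
  s' (Sum.inl 0) = s (Sum.inl 0) + 1 ∧ (∃ w : Unit → ℕ, s (Sum.inl 1) = w () + 1) ∧
    s' (Sum.inl 1) = f (List.Vector.ofFn fun i : Fin (n + 1) => s (Fin.cases (Sum.inl 0) Sum.inr i)) ∧
    ∀ i, s' (Sum.inr i) = s (Sum.inr i)

theorem rfindStep_args (s : Fin 2 ⊕ Fin n → ℕ) :
    (List.Vector.ofFn fun i : Fin (n + 1) => s (Fin.cases (Sum.inl 0) Sum.inr i)) =
      s (Sum.inl 0) ::ᵥ List.Vector.ofFn fun i => s (Sum.inr i) := by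
  simp [List.Vector.ofFn]

/-- Every step out of a state requires its stored value to be nonzero, so a run that reaches counter
`k + 1` has checked all arguments below `k`, and the value at `k` is still stored for inspection. -/
theorem transGen_rfindStep {s s' : Fin 2 ⊕ Fin n → ℕ} (h : Relation.TransGen (RfindStep f) s s')
    (h0 : s (Sum.inl 0) = 0) :
    (∀ i, s' (Sum.inr i) = s (Sum.inr i)) ∧ ∃ k, s' (Sum.inl 0) = k + 1 ∧
      s' (Sum.inl 1) = f (k ::ᵥ List.Vector.ofFn fun i => s (Sum.inr i)) ∧
      ∀ j < k, f (j ::ᵥ List.Vector.ofFn fun i => s (Sum.inr i)) ≠ 0 := by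
  induction h with
  | single h =>
    obtain ⟨h3, -, h5, h6⟩ := h
    rw [rfindStep_args, h0] at h5
    exact ⟨h6, 0, by rw [h3, h0], h5, by simp⟩
  | tail _ h ih =>
    obtain ⟨h3, ⟨w, h4⟩, h5, h6⟩ := h
    obtain ⟨h7, k, h8, h9, h10⟩ := ih
    rw [rfindStep_args] at h5
    refine ⟨fun i => (h6 i).trans (h7 i), k + 1, by rw [h3, h8], by simp only [h5, h8, h7], ?_⟩
    intro j hj
    rcases Nat.lt_succ_iff_lt_or_eq.1 hj with hj | rfl
    · exact h10 j hj
    · rw [← h9, h4]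
      simp

/-- The `k`-th state of an unbounded search. -/
def rfindState (f : List.Vector ℕ (n + 1) → ℕ) (v : Fin n → ℕ) : ℕ → Fin 2 ⊕ Fin n → ℕ
  -- The value 1 is an arbitrary nonzero number that permits the first step.
  | 0 => Sum.elim ![0, 1] v
  | k + 1 => Sum.elim ![k + 1, f (k ::ᵥ List.Vector.ofFn v)] v

theorem transGen_rfindState (v : Fin n → ℕ) (k : ℕ)
    (h : ∀ j < k, f (j ::ᵥ List.Vector.ofFn v) ≠ 0) :
    Relation.TransGen (RfindStep f) (rfindState f v 0) (rfindState f v (k + 1)) := by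
  induction k with
  | zero =>
    refine .single ⟨rfl, ⟨0, rfl⟩, ?_, fun i => rfl⟩
    rw [rfindStep_args]
    rfl
  | succ k ih =>
    refine .tail (ih fun j hj => h j (by omega)) ⟨rfl, ?_, ?_, fun i => rfl⟩
    · obtain ⟨m, hm⟩ := Nat.exists_eq_succ_of_ne_zero (h k (by omega))
      exact ⟨fun _ => m, hm⟩
    · rw [rfindStep_args]
      rfl

theorem rfind (hf : RepresentableGraph fun v => Part.some (f v)) :
    RepresentableGraph fun v => Nat.rfind fun k => Part.some (decide (f (k ::ᵥ v) = 0)) := by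
  let σ := Fin 2 ⊕ Fin n
  have hstep : Representable fun u : σ ⊕ σ → ℕ =>
      RfindStep f (fun i => u (Sum.inl i)) fun i => u (Sum.inr i) := by
    refine (Representable.succ (Sum.inr (Sum.inl 0)) (Sum.inl (Sum.inl 0))).and
      ((Representable.ex (Representable.succ (Sum.inl (Sum.inl (Sum.inl 1))) (Sum.inr ()))).and
        (Representable.and ?_
          (Representable.all fun i => Representable.eq (Sum.inr (Sum.inr i)) (Sum.inl (Sum.inr i)))))
    exact (hf.apply (ι := σ ⊕ σ) (Sum.inr (Sum.inl 1)) fun i : Fin (n + 1) =>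
      Sum.inl (Fin.cases (Sum.inl 0) Sum.inr i)).congr fun v => by simp
  have htrans := Representable.transGen hstep
  have h := (htrans.comap (ι' := Option (Fin n) ⊕ (σ ⊕ σ)) Sum.inr).and
    ((Representable.zero (Sum.inr (Sum.inl (Sum.inl 0)))).and
    ((Representable.zero (Sum.inr (Sum.inr (Sum.inl 1)))).and
    ((Representable.all fun i : Fin n =>
      Representable.eq (Sum.inr (Sum.inl (Sum.inr i))) (Sum.inl (some i))).and
    (Representable.succ (Sum.inr (Sum.inr (Sum.inl 0))) (Sum.inl none)))))
  refine (Representable.ex (P := fun v w => Relation.TransGen (RfindStep f) (fun i => w (Sum.inl i))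
    (fun i => w (Sum.inr i)) ∧ w (Sum.inl (Sum.inl 0)) = 0 ∧ w (Sum.inr (Sum.inl 1)) = 0 ∧
      (∀ i : Fin n, w (Sum.inl (Sum.inr i)) = v (some i)) ∧
      w (Sum.inr (Sum.inl 0)) = v none + 1) h).congr fun v => ?_
  refine Iff.trans Nat.mem_rfind ?_
  simp only [Part.mem_some_iff, eq_comm (a := true), eq_comm (a := false), decide_eq_true_iff,
    decide_eq_false_iff_not]
  constructor
  · rintro ⟨h1, h2⟩
    exact ⟨Sum.elim (rfindState f (fun i => v (some i)) 0)
      (rfindState f (fun i => v (some i)) (v none + 1)), transGen_rfindState _ _ fun j hj => h2 hj,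
      rfl, h1, fun i => rfl, rfl⟩
  · rintro ⟨w, h1, h2, h3, h4, h5⟩
    obtain ⟨-, k, h7, h8, h9⟩ := transGen_rfindStep h1 h2
    simp only [h4] at h8 h9
    obtain rfl : v none = k := by omega
    exact ⟨by rw [← h8, h3], fun {m} hm => h9 m hm⟩

end rfind

theorem of_primrec' {f : List.Vector ℕ n → ℕ} (hf : Nat.Primrec' f) :
    RepresentableGraph fun v => Part.some (f v) := by
  induction hf with
  | zero => exact zero
  | succ => exact succ
  | get i => exact get i
  | comp g _ _ ihf ihg =>
    have h := ihf.comp ihg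
    simpa only [Part.bind_eq_bind, Vector.mOfFn_part_some, Part.bind_some] using h
  | prec _ _ ihf ihg => exact prec ihf ihg

theorem of_partrec' {f : List.Vector ℕ n →. ℕ} (hf : Nat.Partrec' f) : RepresentableGraph f := by
  induction hf with
  | prim hf => exact of_primrec' hf
  | comp g _ _ ihf ihg => exact ihf.comp ihg
  | rfind _ ih => exact rfind ih

end RepresentableGraph

/-! ### Splicing accepting runs -/

namespace TapeAut

variable {ι α Q : Type}

/-- A run on a tape content `p ++ r` of the tape `i₀` either accepts without reading `r`, or it can
be cut when exactly `p` has been read on this tape. -/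
theorem Acc.cut {A : TapeAut ι α Q} {q : Q} {t : ι → List (Option α)} (h : A.Acc q t) (i₀ : ι)
    {p r : List (Option α)} (hp : t i₀ = p ++ r) :
    (∀ r', A.Acc q (setTape t i₀ (p ++ r'))) ∨
      ∃ (q' : Q) (t' c : ι → List (Option α)), c i₀ = p ∧ (∀ i, t i = c i ++ t' i) ∧ A.Acc q' t' ∧
        ∀ t'', A.Acc q' t'' → A.Acc q fun i => c i ++ t'' i := by
  classical
  induction h generalizing p with
  | done hq => exact .inl fun _ => .done hq
  | @step q t s y q' h1 h2 h3 ih =>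
    by_cases hi : i₀ = A.tape q
    · cases p with
      | nil =>
        exact .inr ⟨q, t, fun _ => [], rfl, fun _ => rfl, .step h1 h2 h3, fun _ h => h⟩
      | cons s' p =>
        rw [← hi, hp, List.cons_append, List.cons.injEq] at h1
        obtain ⟨rfl, rfl⟩ := h1
        rw [← hi] at ih
        rcases ih (p := p) (by simp) with H | ⟨q₁, t₁, c, hc, htc, hacc, H⟩
        · left
          intro r'
          refine .step (s := s') (y := p ++ r') (by simp [← hi]) h2 ?_
          simpa [← hi] using H r'
        · right
          refine ⟨q₁, t₁, setTape c i₀ (s' :: p), by simp, fun i => ?_, hacc, fun t'' h'' => ?_⟩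
          · by_cases h : i = i₀
            · subst h
              have := htc i
              simp only [setTape_self, hc] at this
              rw [hp, List.append_cancel_left this]
              simp
            · have := htc i
              rwa [setTape_of_ne _ _ h] at this ⊢
          · refine .step (s := s') (y := p ++ t'' i₀) (by simp [← hi]) h2 ?_
            convert H t'' h'' using 1
            funext i
            by_cases h : i = i₀
            · subst h; simp [← hi, hc]
            · rw [← hi, setTape_of_ne _ _ h, setTape_of_ne _ _ h]
    · rcases ih (p := p) (by rw [setTape_of_ne _ _ hi, hp]) with H | ⟨q₁, t₁, c, hc, htc, hacc, H⟩
      · left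
        intro r'
        refine .step (s := s) (y := y) ?_ h2 ?_
        · rw [setTape_of_ne _ _ (Ne.symm hi), h1]
        · rw [setTape_comm _ hi]
          exact H r'
      · right
        refine ⟨q₁, t₁, setTape c (A.tape q) (s :: c (A.tape q)), ?_, fun i => ?_, hacc,
          fun t'' h'' => ?_⟩
        · rw [setTape_of_ne _ _ hi, hc]
        · by_cases h : i = A.tape q
          · have := htc (A.tape q)
            rw [setTape_self] at this
            simp [h, h1, this]
          · have := htc i
            rwa [setTape_of_ne _ _ h] at this ⊢
        · refine .step (s := s) (y := c (A.tape q) ++ t'' (A.tape q)) (by simp) h2 ?_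
          convert H t'' h'' using 1
          funext i
          by_cases h : i = A.tape q
          · subst h; simp
          · rw [setTape_of_ne _ _ h, setTape_of_ne _ _ h]

theorem setTape_endMarked (x : ι → List α) (i : ι) (l : List α) :
    setTape (fun j => endMarked (x j)) i (endMarked l) = fun j => endMarked (setTape x i l j) := by
  funext j
  by_cases h : j = i
  · subst h; simp
  · simp [setTape_of_ne _ _ h]

/-- In an infinite sequence of accepted inputs, split on one tape into prefixes and suffixes, the
prefix of one input can be combined with the suffix of another one. -/
theorem exists_accepts_splice [Finite ι] [Finite Q] (A : TapeAut ι α Q) (i₀ : ι)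
    (x : ℕ → ι → List α) (p s : ℕ → List α) (hx : ∀ k, A.Accepts (x k))
    (hps : ∀ k, x k i₀ = p k ++ s k) :
    ∃ k l, k ≠ l ∧ ∃ y, A.Accepts y ∧ y i₀ = p k ++ s l := by
  by_contra hcon
  push Not at hcon
  choose q₀ hq₀ hacc using hx
  have hcut : ∀ k, ∃ (q' : Q) (t' c : ι → List (Option α)),
      c i₀ = (p k).map some ∧ (∀ i, endMarked (x k i) = c i ++ t' i) ∧ A.Acc q' t' ∧
      ∀ t'', A.Acc q' t'' → A.Acc (q₀ k) fun i => c i ++ t'' i := fun k => by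
    -- If the run accepts without depending on the suffix, the suffix of the next input can be
    -- substituted directly.
    refine ((hacc k).cut i₀ (p := (p k).map some) (r := endMarked (s k))
      (by rw [hps, endMarked_append])).resolve_left fun H => ?_
    have h1 := H (endMarked (s (k + 1)))
    rw [← endMarked_append, setTape_endMarked] at h1
    exact hcon k (k + 1) (by omega) _ ⟨_, hq₀ k, h1⟩ (by simp)
  choose q t c hc htc hacc' H using hcut
  -- Pigeonhole on the state at the cut together with the set of exhausted tapes. Equality of these
  -- sets ensures that on each tape the consumed part and the foreign remainder together carry
  -- exactly one end marker.
  obtain ⟨k, l, hkl, h⟩ := Finite.exists_ne_map_eq_of_infinite fun k => (q k, {i | t k i = []})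
  obtain ⟨hq, hD⟩ := Prod.mk.inj h
  have hD' : ∀ i, t k i = [] ↔ t l i = [] := fun i => Set.ext_iff.1 hD i
  have hword : ∀ i, ∃ y, c k i ++ t l i = endMarked y ∧ (i = i₀ → y = p k ++ s l) := fun i => by
    by_cases hi : i = i₀
    · subst hi
      refine ⟨p k ++ s l, ?_, fun _ => rfl⟩
      have h1 := htc l i
      rw [hps, endMarked_append, hc] at h1
      rw [← List.append_cancel_left h1, endMarked_append, hc]
    · by_cases ht : t k i = []
      · refine ⟨x k i, ?_, fun h => absurd h hi⟩
        rw [htc k i, ht, (hD' i).1 ht]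
      · obtain ⟨u, v, h1, h2, -⟩ := append_eq_endMarked (htc k i).symm ht
        obtain ⟨u', v', h1', h2', -⟩ := append_eq_endMarked (htc l i).symm
          (fun h => ht ((hD' i).2 h))
        refine ⟨u ++ v', ?_, fun h => absurd h hi⟩
        rw [endMarked_append, h1, h2']
  choose y hy hy₀ using hword
  refine hcon k l hkl y ⟨q₀ k, hq₀ k, ?_⟩ (hy₀ i₀ rfl)
  have := H k (t l) (hq ▸ hacc' l)
  simpa only [hy] using this

end TapeAut

/-! ### Translation to multi-tape automata over finite alphabets -/

namespace MultiTapeAutomaton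

variable {n : ℕ} {α Q : Type}

/-- An `n`-tape automaton as an automaton with tapes indexed by `Fin n`. -/
def toTapeAut (A : MultiTapeAutomaton n α Q) : TapeAut (Fin n) α Q :=
  ⟨A.tape, A.trans, A.start, A.accept⟩

theorem acc_toTapeAut_iff (A : MultiTapeAutomaton n α Q) (q : Q) (t : Fin n → List (Option α)) :
    A.toTapeAut.Acc q t ↔ ∃ q' ∈ A.accept, ∃ y, Relation.ReflTransGen A.Step (q, t) (q', y) := by
  have hset : ∀ (t : Fin n → List (Option α)) i y, setTape t i y = Function.update t i y := by
    intro t i y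
    funext j
    simp [setTape, Function.update]
  constructor
  · intro h
    induction h with
    | done hq => exact ⟨_, hq, _, .refl⟩
    | @step q t s y q' h1 h2 h3 ih =>
      obtain ⟨q₁, hq₁, z, hz⟩ := ih
      have hstep : A.Step (q, t) (q', setTape t (A.tape q) y) := ⟨s, y, h1, h2, hset t _ y⟩
      exact ⟨q₁, hq₁, z, .head hstep hz⟩
  · rintro ⟨q', hq', y, h⟩
    generalize hc : (q, t) = c at h
    induction h using Relation.ReflTransGen.head_induction_on generalizing q t with
    | refl =>
      obtain ⟨rfl, rfl⟩ := Prod.mk.inj hc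
      exact .done hq'
    | @head c c' hstep _ ih =>
      subst hc
      obtain ⟨s, y, h1, h2, h3⟩ := hstep
      refine .step (A := A.toTapeAut) h1 h2 (ih _ _ (Prod.ext rfl ?_))
      exact (hset t _ y).trans h3.symm

theorem accepts_toTapeAut_iff (A : MultiTapeAutomaton n α Q) (x : Fin n → List α) :
    A.toTapeAut.Accepts x ↔ x ∈ A.language := by
  have h : inputTapes x = fun i => endMarked (x i) := rfl
  simp only [language, Accepts, Set.mem_ofPred_eq, TapeAut.Accepts, acc_toTapeAut_iff, h]
  rfl

end MultiTapeAutomaton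

/-- For a partial recursive function `g` there is a set of tuples of words with rational complement
such that on the tape `i₀` exactly the elements of the domain of `g` occur, in unary notation, and
on the tape `i₁` there are words `u ++ 0 :: u`, where `u` can be any word over `{0, 1}`
independently of the tape `i₀`. -/
theorem exists_coRat_of_partrec {g : ℕ →. ℕ} (hg : Partrec g) :
    ∃ (ι : Type) (_ : Finite ι) (i₀ i₁ : ι) (k : ℕ) (S : Set (ι → List ℕ)), CoRat S ∧
      (∀ x ∈ S, ∀ i, ∀ c ∈ x i, c < k) ∧
      (∀ n, (g n).Dom → ∀ u : List ℕ, (∀ c ∈ u, c < 2) →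
        ∃ x ∈ S, x i₀ = List.replicate n 0 ∧ x i₁ = u ++ 0 :: u) ∧
      ∀ x ∈ S, ∃ n, (g n).Dom ∧ x i₀ = List.replicate n 0 ∧ ∃ u, x i₁ = u ++ 0 :: u := by
  have hgraph : RepresentableGraph fun v : List.Vector ℕ 1 => g v.head :=
    RepresentableGraph.of_partrec' (Nat.Partrec'.part_iff₁.2 hg)
  -- Three tapes independent of the graph hold u, an equal copy of u, and their concatenation around
  -- 0.
  have h := (hgraph.comap_injective (ι' := Option (Fin 1) ⊕ Fin 3) Sum.inl Sum.inl_injective).and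
    ((ProjCoRat.cat 2 0 (i := (Sum.inr 0 : Option (Fin 1) ⊕ Fin 3)) (j := Sum.inr 1)
      (l := Sum.inr 2) (by simp) (by simp) (by simp)).and
      (ProjCoRat.eq 2 (Sum.inr 0) (Sum.inr 1)))
  obtain ⟨κ, hκ, k, S, hS, hk, hP⟩ := h
  have hSP := fun x (hx : x ∈ S) => (hP (fun i => x (.inl i))).2 ⟨fun i => x (.inr i),
    Set.mem_of_eq_of_mem (s := S) (by funext i; rcases i with i | i <;> rfl) hx⟩
  refine ⟨_, inferInstance, .inl (.inl (some 0)), .inl (.inr 2), max 2 k, S, hS, ?_, ?_, ?_⟩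
  · rintro x hx ((i | i) | i) c hc
    · obtain ⟨⟨v, -, hv⟩, -⟩ := hSP x hx
      have h1 := congrFun hv i
      dsimp only at h1
      rw [h1] at hc
      simp [eq_zero_of_mem_unary hc]
    · obtain ⟨-, ⟨h1, h2, h3⟩, -⟩ := hSP x hx
      refine lt_max_of_lt_left ?_
      dsimp only at h1
      fin_cases i
      · exact h2 c hc
      · exact h3 c hc
      · change c ∈ x (.inl (.inr 2)) at hc
        rw [h1] at hc
        simp only [List.mem_append, List.mem_cons] at hc
        rcases hc with hc | rfl | hc
        · exact h2 c hc
        · omega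
        · exact h3 c hc
    · exact lt_max_of_lt_right (hk x hx i c hc)
  · intro n hn u hu
    obtain ⟨w, hw⟩ := (hP (Sum.elim (unary fun o => o.elim ((g n).get hn) fun _ => n)
      ![u, u, u ++ 0 :: u])).1
      ⟨⟨_, by simpa using Part.get_mem hn, rfl⟩, ⟨rfl, hu, hu⟩, rfl, hu⟩
    exact ⟨_, hw, rfl, rfl⟩
  · intro x hx
    obtain ⟨⟨v, hv, hxv⟩, ⟨h1, -⟩, h2, -⟩ := hSP x hx
    refine ⟨v (some 0), ?_, congrFun hxv (some 0), x (.inl (.inr 0)), ?_⟩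
    · simp only [List.Vector.ofFn, List.Vector.head_cons] at hv
      exact Part.dom_iff_mem.2 ⟨_, hv⟩
    · dsimp only at h1 h2
      rw [h1, ← h2]

-- Tapes and states are numbered, and the alphabet is cut down to the letters that occur in `S`,
-- enlarged so that 0 and 1 are always distinct letters. Tuples of `S` lift back because their
-- letters are below `k`.
open MultiTapeAutomaton in
theorem exists_automaton_of_partrec {g : ℕ →. ℕ} (hg : Partrec g) :
    ∃ (N k m : ℕ) (A : MultiTapeAutomaton (N + 1) (Fin (k + 1 + 1)) (Fin m)) (i₀ i₁ : Fin (N + 1)),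
      (∀ n, (g n).Dom → ∀ j, ∃ x ∉ A.language, x i₀ = List.replicate n 0 ∧
        x i₁ = List.replicate j 1 ++ 0 :: List.replicate j 1) ∧
      ∀ x ∉ A.language, ∃ n, (g n).Dom ∧ x i₀ = List.replicate n 0 ∧ ∃ u, x i₁ = u ++ 0 :: u := by
  obtain ⟨ι, hι, j₀, j₁, k, S, ⟨Q, hQ, A₀, hA₀⟩, hk, hS, hS'⟩ := exists_coRat_of_partrec hg
  obtain ⟨m, ⟨f⟩⟩ := Finite.exists_equiv_fin Q
  obtain ⟨N, ⟨e⟩⟩ : ∃ N, Nonempty (ι ≃ Fin (N + 1)) := by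
    obtain ⟨N, ⟨e⟩⟩ := Finite.exists_equiv_fin ι
    have := (e j₀).pos
    obtain ⟨N, rfl⟩ := Nat.exists_eq_succ_of_ne_zero this.ne'
    exact ⟨N, ⟨e⟩⟩
  let A : MultiTapeAutomaton (N + 1) (Fin (k + 1 + 1)) (Fin m) :=
    ⟨fun q => e (A₀.tape (f.symm q)), fun q s => f '' A₀.trans (f.symm q) (s.map Fin.val),
      f '' A₀.start, f '' A₀.accept⟩
  have hA : ∀ x, x ∉ A.language ↔ (fun i => (x (e i)).map Fin.val) ∈ S := by
    intro x
    have key : ∀ q, A₀.Acc (f.symm q) (fun i => endMarked ((x (e i)).map Fin.val)) ↔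
        A.toTapeAut.Acc q fun i => endMarked (x i) := by
      intro q
      refine TapeAut.acc_hom f.symm e.symm Fin.val e.symm.injective ?_ ?_ ?_ q _ _ ?_
      · simp [A, toTapeAut]
      · intro q s q''
        constructor
        · intro h
          exact ⟨f q'', ⟨q'', h, rfl⟩, by simp⟩
        · rintro ⟨q', ⟨q₁, h, rfl⟩, rfl⟩
          simpa using h
      · intro q
        simp [A, toTapeAut]
      · simp [endMarked_map]
    rw [hA₀, ← accepts_toTapeAut_iff, TapeAut.Accepts, TapeAut.Accepts]
    refine not_congr ?_
    simp only [← key]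
    constructor
    · rintro ⟨q, ⟨q₁, hq₁, rfl⟩, h⟩
      exact ⟨q₁, hq₁, by simpa using h⟩
    · rintro ⟨q, hq, h⟩
      exact ⟨f q, ⟨q, hq, rfl⟩, by simpa using h⟩
  have hmap : ∀ l l' : List (Fin (k + 1 + 1)), l.map Fin.val = l'.map Fin.val → l = l' :=
    fun l l' h => List.map_injective_iff.2 Fin.val_injective h
  refine ⟨N, k, m, A, e j₀, e j₁, fun n hn j => ?_, fun x hx => ?_⟩
  · obtain ⟨x, hx, h0, h1⟩ := hS n hn (List.replicate j 1) (by simp)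
    have hlift : ∀ i, ((x i).map (Fin.ofNat (k + 1 + 1))).map Fin.val = x i := fun i => by
      rw [List.map_map, List.map_congr_left (g := id), List.map_id]
      intro c hc
      have := hk x hx i c hc
      simp only [Function.comp_apply, Fin.val_ofNat, id]
      exact Nat.mod_eq_of_lt (by omega)
    refine ⟨fun i => (x (e.symm i)).map (Fin.ofNat (k + 1 + 1)), ?_, ?_, ?_⟩
    · rw [hA]
      simpa only [Equiv.symm_apply_apply, hlift] using hx
    · exact hmap _ _ (by simp [h0])
    · exact hmap _ _ (by simp [h1])
  · obtain ⟨n, hn, h0, u, h1⟩ := hS' _ ((hA x).1 hx)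
    refine ⟨n, hn, hmap _ _ (by simp [h0]), ?_⟩
    obtain ⟨a, b, h2, h3, h4⟩ := List.map_eq_append_iff.1 h1
    obtain ⟨c, d, rfl, h5, h6⟩ := List.map_eq_cons_iff.1 h4
    refine ⟨a, ?_⟩
    rw [h2, hmap d a (h6.trans h3.symm), show c = 0 from Fin.ext h5]

/-! ### Fixing the word on one tape by a computable chain of states -/

/-- A code for an automaton, given by lists, extended by a chain of states that accepts if the
tape `i₀` holds a word of zeros whose length is not `n`. -/
def chainCode (N k m : ℕ) (tapes : List ℕ) (tr : List (ℕ × Option ℕ × ℕ)) (st ac : List ℕ)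
    (i₀ n : ℕ) : AutomatonCode :=
  (N, k, m + (n + 2), tapes ++ (List.range (n + 2)).map fun _ => i₀,
    -- State `m + i` has read `i` zeros. For `i < n` the end marker shows that the word is too
    -- short; one more zero in state `m + n` shows that it is too long. State `m + n` has no move at
    -- the end marker, so the length `n` alone is rejected.
    tr ++ ((List.range (n + 1)).map (fun i => (m + i, some 0, m + i + 1)) ++
      (List.range n).map fun i => (m + i, none, m + (n + 1))),
    st ++ [m], ac ++ [m + (n + 1)])

theorem computable_chainCode (N k m : ℕ) (tapes : List ℕ) (tr : List (ℕ × Option ℕ × ℕ))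
    (st ac : List ℕ) (i₀ : ℕ) : Computable (chainCode N k m tapes tr st ac i₀) := by
  refine Primrec.to_comp ?_
  have hadd : ∀ c, Primrec fun n : ℕ => n + c := fun c => Primrec.nat_add.comp .id (.const c)
  have hm : Primrec fun n : ℕ => m + n := Primrec.nat_add.comp (.const m) .id
  refine .pair (.const N) (.pair (.const k) (.pair (hm.comp (hadd 2)) (.pair ?_ (.pair ?_
    (.pair (.const _) ?_)))))
  · exact Primrec.list_append.comp (.const _)
      (Primrec.list_map (Primrec.list_range.comp (hadd 2)) (Primrec.const _).to₂)
  · refine Primrec.list_append.comp (.const _) (Primrec.list_append.comp ?_ ?_)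
    · refine Primrec.list_map (Primrec.list_range.comp (hadd 1)) ?_
      exact Primrec.pair (hm.comp .snd) (.pair (.const _) ((hadd 1).comp (hm.comp .snd)))
    · refine Primrec.list_map Primrec.list_range ?_
      exact Primrec.pair (hm.comp .snd) (.pair (.const _) (hm.comp ((hadd 1).comp .fst)))
  · exact Primrec.list_append.comp (.const _)
      (Primrec.list_cons.comp (hm.comp (hadd 1)) (.const _))

open MultiTapeAutomaton in
/-- The language of an automaton extended by a chain. -/
theorem exists_chainCode {N k m : ℕ} (A : MultiTapeAutomaton (N + 1) (Fin (k + 1)) (Fin m))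
    (i₀ : Fin (N + 1)) (hA : ∀ x ∉ A.language, ∃ j, x i₀ = List.replicate j 0) :
    ∃ tapes tr st ac, ∀ n (x : Fin (N + 1) → List (Fin (k + 1))),
      x ∉ (AutomatonCode.toAutomaton (chainCode N k m tapes tr st ac i₀ n)).language ↔
        x ∉ A.language ∧ x i₀ = List.replicate n 0 := by
  obtain ⟨tr, htr⟩ : ∃ tr : List (ℕ × Option ℕ × ℕ), ∀ t, t ∈ tr ↔
      ∃ q s q', q' ∈ A.trans q s ∧ t = (q.val, s.map Fin.val, q'.val) := by
    have hfin : {t : ℕ × Option ℕ × ℕ |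
        ∃ q s q', q' ∈ A.trans q s ∧ t = (q.val, s.map Fin.val, q'.val)}.Finite :=
      (Set.finite_range fun p : Fin m × Option (Fin (k + 1)) × Fin m =>
        (p.1.val, p.2.1.map Fin.val, p.2.2.val)).subset fun t ⟨q, s, q', _, ht⟩ =>
          ⟨(q, s, q'), ht.symm⟩
    exact ⟨hfin.toFinset.toList, fun t => by simp⟩
  have hlist : ∀ X : Set (Fin m), ∃ l : List ℕ, ∀ n, n ∈ l ↔ ∃ q ∈ X, n = q.val := fun X => by
    have hfin : {n | ∃ q ∈ X, n = q.val}.Finite :=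
      (Set.finite_range (Fin.val : Fin m → ℕ)).subset fun n ⟨q, _, hq⟩ => ⟨q, hq.symm⟩
    exact ⟨hfin.toFinset.toList, fun t => by simp⟩
  obtain ⟨st, hst⟩ := hlist A.start
  obtain ⟨ac, hac⟩ := hlist A.accept
  refine ⟨List.ofFn fun q => (A.tape q).val, tr, st, ac, fun n x => ?_⟩
  let B : TapeAut (Fin (N + 1)) (Fin (k + 1)) (Fin (m + (n + 2))) :=
    (AutomatonCode.toAutomaton (chainCode N k m (List.ofFn fun q => (A.tape q).val) tr st ac
      i₀ n)).toTapeAut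
  have hBtape : ∀ q, B.tape q = Fin.ofNat (N + 1) (((List.ofFn fun q => (A.tape q).val) ++
      (List.range (n + 2)).map fun _ => i₀.val).getD q.val 0) := fun q => rfl
  have hBtrans : ∀ q s q', q' ∈ B.trans q s ↔ (q.val, s.map Fin.val, q'.val) ∈ tr ++
      ((List.range (n + 1)).map (fun i => (m + i, some 0, m + i + 1)) ++
      (List.range n).map fun i => (m + i, none, m + (n + 1))) := fun q s q' => Iff.rfl
  have hBstart : ∀ q, q ∈ B.start ↔ q.val ∈ st ++ [m] := fun q => Iff.rfl
  have hBaccept : ∀ q, q ∈ B.accept ↔ q.val ∈ ac ++ [m + (n + 1)] := fun q => Iff.rfl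
  simp only [List.mem_append, htr, hst, hac, List.mem_map, List.mem_range, List.mem_singleton]
    at hBtrans hBstart hBaccept
  have hBA : ∀ q t, B.Acc (Fin.castAdd (n + 2) q) t ↔ A.toTapeAut.Acc q t := by
    intro q t
    refine TapeAut.acc_hom (Fin.castAdd (n + 2)) id id Function.injective_id ?_ ?_ ?_ q t t ?_
    · intro q
      rw [hBtape, List.getD_append _ _ _ _ (by simp)]
      simp [List.getD, toTapeAut]
    · intro q s q''
      rw [hBtrans]
      constructor
      · rintro (⟨q₁, s₁, q₂, h, heq⟩ | ⟨i, -, heq⟩ | ⟨i, -, heq⟩) <;>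
          simp only [Prod.mk.injEq, Fin.val_castAdd] at heq
        · obtain ⟨h1, h2, h3⟩ := heq
          obtain rfl := Fin.ext h1
          obtain rfl : s = s₁ := Option.map_injective Fin.val_injective (by simpa using h2)
          exact ⟨q₂, h, Fin.ext h3.symm⟩
        · omega
        · omega
      · rintro ⟨q', h, rfl⟩
        exact .inl ⟨q, s, q', h, by simp⟩
    · intro q
      rw [hBaccept]
      constructor
      · rintro (⟨q', h, heq⟩ | heq)
        · obtain rfl : q = q' := Fin.ext heq
          exact h
        · simp only [Fin.val_castAdd] at heq
          omega
      · intro h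
        exact .inl ⟨q, h, rfl⟩
    · simp
  -- In chain state `i` with `j` zeros left, the total length is `i + j`; for `i = n + 1` the
  -- inequality holds automatically.
  have hchain : ∀ (j i : ℕ) (hi : i ≤ n + 1) (t : Fin (N + 1) → List (Option (Fin (k + 1)))),
      t i₀ = endMarked (List.replicate j 0) →
      (B.Acc (Fin.natAdd m ⟨i, by omega⟩) t ↔ i + j ≠ n) := by
    have htape : ∀ i (hi : i ≤ n + 1), B.tape (Fin.natAdd m ⟨i, by omega⟩) = i₀ := by
      intro i hi
      rw [hBtape, List.getD_append_right _ _ _ _ (by simp)]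
      have : i < n + 2 := by omega
      simp [List.getD, this]
    have hacc : B.Acc (Fin.natAdd m ⟨n + 1, by omega⟩) = fun _ => True := by
      funext t
      simp only [eq_iff_iff, iff_true]
      exact .done ((hBaccept _).2 (.inr rfl))
    have hnot : ∀ i (hi : i ≤ n), Fin.natAdd m ⟨i, by omega⟩ ∉ B.accept := by
      intro i hi
      rw [hBaccept]
      rintro (⟨q', -, heq⟩ | heq) <;> simp only [Fin.val_natAdd] at heq <;> omega
    have htrans : ∀ i (hi : i ≤ n) s q, q ∈ B.trans (Fin.natAdd m ⟨i, by omega⟩) s ↔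
        (s = some 0 ∧ q = Fin.natAdd m ⟨i + 1, by omega⟩) ∨
        (s = none ∧ i < n ∧ q = Fin.natAdd m ⟨n + 1, by omega⟩) := by
      intro i hi s q
      rw [hBtrans]
      constructor
      · rintro (⟨q₁, s₁, q₂, h, heq⟩ | ⟨i', hi', heq⟩ | ⟨i', hi', heq⟩) <;>
          simp only [Prod.mk.injEq, Fin.val_natAdd] at heq
        · omega
        · left
          obtain ⟨c, rfl, hc⟩ := Option.map_eq_some_iff.1 heq.2.1.symm
          refine ⟨congrArg some (Fin.ext hc), Fin.ext ?_⟩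
          simp only [Fin.val_natAdd]
          omega
        · right
          refine ⟨Option.map_eq_none_iff.1 heq.2.1.symm, by omega, Fin.ext ?_⟩
          simp only [Fin.val_natAdd]
          omega
      · rintro (⟨rfl, rfl⟩ | ⟨rfl, h, rfl⟩)
        · exact .inr (.inl ⟨i, by omega, by simp [Nat.add_assoc]⟩)
        · exact .inr (.inr ⟨i, h, by simp⟩)
    intro j
    induction j with
    | zero =>
      intro i hi t ht
      rcases Nat.lt_or_ge n i with h | h
      · obtain rfl : i = n + 1 := by omega
        simp only [hacc, Nat.add_zero, true_iff]
        omega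
      · rw [B.acc_iff_of_cons (hnot i h) (by rw [htape i hi, ht]; rfl)]
        simp only [htrans i h, reduceCtorEq, false_and, true_and, false_or,
          Nat.add_zero]
        constructor
        · rintro ⟨q, ⟨hin, -⟩, -⟩
          omega
        · intro hin
          exact ⟨_, ⟨by omega, rfl⟩, by rw [hacc]; trivial⟩
    | succ j ih =>
      intro i hi t ht
      rcases Nat.lt_or_ge n i with h | h
      · obtain rfl : i = n + 1 := by omega
        simp only [hacc, true_iff]
        omega
      · have ht' : t (B.tape (Fin.natAdd m ⟨i, by omega⟩)) =
            some 0 :: endMarked (List.replicate j 0) := by rw [htape i hi, ht]; rfl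
        rw [B.acc_iff_of_trans_eq (q' := Fin.natAdd m ⟨i + 1, by omega⟩) (hnot i h) ht'
          (by ext q; rw [htrans i h]; simp), ih (i + 1) (by omega) _ (by rw [htape i hi]; simp)]
        omega
  have hB : x ∈ (AutomatonCode.toAutomaton (chainCode N k m (List.ofFn fun q => (A.tape q).val) tr
      st ac i₀ n)).language ↔ x ∈ A.language ∨
      B.Acc (Fin.natAdd m ⟨0, by omega⟩) fun i => endMarked (x i) := by
    refine (accepts_toTapeAut_iff (AutomatonCode.toAutomaton (chainCode N k m
      (List.ofFn fun q => (A.tape q).val) tr st ac i₀ n)) x).symm.trans ?_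
    rw [← accepts_toTapeAut_iff]
    change (∃ q ∈ B.start, B.Acc q _) ↔ _
    simp only [hBstart]
    constructor
    · rintro ⟨q, ⟨q₁, hq₁, heq⟩ | heq, h⟩
      · obtain rfl : q = Fin.castAdd (n + 2) q₁ := Fin.ext heq
        exact .inl ⟨q₁, hq₁, (hBA _ _).1 h⟩
      · have hq : q = Fin.natAdd m ⟨0, by omega⟩ := Fin.ext heq
        exact .inr (hq ▸ h)
    · rintro (⟨q, hq, h⟩ | h)
      · exact ⟨_, .inl ⟨q, hq, rfl⟩, (hBA _ _).2 h⟩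
      · exact ⟨_, .inr rfl, h⟩
  rw [hB, not_or]
  refine and_congr_right fun hx => ?_
  obtain ⟨j, hj⟩ := hA x hx
  rw [hchain j 0 (by omega) _ (by rw [hj]), hj]
  simp

/-- The left side contains `a` once, while an `a` in `u` would produce at least three on the right.
So `a` is the separator on both sides, and both runs of `b` equal `u`. -/
theorem eq_of_replicate_append_cons_eq {α : Type} {a b : α} (hab : a ≠ b) {j l : ℕ} {u : List α}
    (h : List.replicate j b ++ a :: List.replicate l b = u ++ a :: u) : j = l := by
  classical
  have hrep : ∀ j : ℕ, a ∉ List.replicate j b := fun j h => hab (List.mem_replicate.1 h).2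
  have hu : a ∉ u := by
    intro hu
    have hcount := congrArg (List.count a) h
    have := List.count_pos_iff.2 hu
    have hc : ∀ j : ℕ, List.count a (List.replicate j b) = 0 := fun j =>
      List.count_eq_zero.2 (hrep j)
    rw [List.count_append, List.count_append, List.count_cons_self, List.count_cons_self, hc,
      hc] at hcount
    omega
  obtain ⟨h1, h2⟩ := append_cons_inj_of_notMem (hrep j) hu h
  simpa using congrArg List.length (h1.trans h2.symm)

/-! ### The reduction from non-halting -/

theorem mainTheorem2 : ¬ REPred (fun c : AutomatonCode => RationalComplement c) := by
  intro hre
  have hg : Partrec fun n => Nat.Partrec.Code.eval (Denumerable.ofNat Nat.Partrec.Code n) 0 :=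
    Nat.Partrec.Code.eval_part.comp (Computable.ofNat _) (Computable.const 0)
  obtain ⟨N, k, m, A, i₀, i₁, hdom, hA⟩ := exists_automaton_of_partrec hg
  obtain ⟨tapes, tr, st, ac, hC⟩ := exists_chainCode A i₀ fun x hx =>
    (hA x hx).imp fun n h => h.2.1
  have hcode : ∀ n, RationalComplement (chainCode N (k + 1) m tapes tr st ac i₀ n) ↔
      ¬ (Nat.Partrec.Code.eval (Denumerable.ofNat Nat.Partrec.Code n) 0).Dom := by
    intro n
    constructor
    · rintro ⟨Q, hQ, B', hB⟩ hn
      let B : MultiTapeAutomaton (N + 1) (Fin (k + 1 + 1)) Q := B'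
      have hBC : ∀ x, x ∈ B.language ↔ x ∉ A.language ∧ x i₀ = List.replicate n 0 := fun x => by
        exact (Set.ext_iff.1 hB x).trans (hC n x)
      choose x hxA hx0 hx1 using hdom n hn
      -- The inputs are cut on tape `i₁` just before the separator 0, so splicing yields `1^j 0 1^l`
      -- with `j ≠ l`.
      obtain ⟨j, l, hjl, y, hy, hy1⟩ := B.toTapeAut.exists_accepts_splice i₁ x
        (fun j => List.replicate j 1) (fun j => 0 :: List.replicate j 1)
        (fun j => (B.accepts_toTapeAut_iff _).2 ((hBC _).2 ⟨hxA j, hx0 j⟩)) hx1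
      obtain ⟨-, -, -, u, hu⟩ := hA y ((hBC y).1 ((B.accepts_toTapeAut_iff _).1 hy)).1
      exact hjl (eq_of_replicate_append_cons_eq (by simp) (hy1.symm.trans hu))
    · intro hn
      -- The slice at a non-halting `n` is empty and is accepted by the automaton without states.
      refine ⟨Empty, inferInstance, ⟨Empty.elim, fun q => q.elim, ∅, ∅⟩, ?_⟩
      ext x
      have : ¬ (x ∉ (AutomatonCode.toAutomaton
          (chainCode N (k + 1) m tapes tr st ac i₀ n)).language) := by
        intro h
        obtain ⟨h1, h2⟩ := (hC n x).1 h
        obtain ⟨n', hn', h3, -⟩ := hA x h1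
        obtain rfl : n = n' := by simpa using congrArg List.length (h2.symm.trans h3)
        exact hn hn'
      simpa [MultiTapeAutomaton.language, MultiTapeAutomaton.Accepts] using this
  refine ComputablePred.halting_problem_not_re 0 (Partrec.of_eq (hre.comp
    ((computable_chainCode N (k + 1) m tapes tr st ac i₀).comp Computable.encode)) fun c => ?_)
  have h := propext (hcode (Encodable.encode c))
  rw [Denumerable.ofNat_encode] at h
  exact congrArg (fun p : Prop => Part.assert p fun _ => Part.some ()) h
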